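/- Let $q$ be a power of an odd prime, let $m,n,t$ be positive integers with $t\le \min(m,n)/2$, let $\mathcal C,\mathcal D\subseteq\mathbb F_q^{m\times n}$ be $\mathbb F_q$-linear matrix codes, and let $a\in\mathbb F_q$, $a\neq 0$. Put $$\mathcal C\diamond_a\mathcal D=\left\{\begin{pmatrix}A_0+B_0 & a(A_1-B_1)\\ A_1+B_1 & A_0-B_0\end{pmatrix} : A_0,A_1\in\mathcal C,\ B_0,B_1\in\mathcal D\right\}\subseteq\mathbb F_q^{2m\times 2n}.$$ A decoder corrects $t$ errors for a code if it recovers the codeword $X$ from $X+F$ whenever $F$ has rank at most $t$; it corrects $t$ erasures if it recovers $X$ from $X+F$ and a matrix $W$ of rank $t$ whenever the row space of $F$ is contained in that of $W$ (or, for the other kind of erasure decoder, the same with column spaces). The statement holds for both kinds. Algorithms are algebraic computation trees over $\mathbb F_q$ (arithmetic operations, tests for zero, calls of subroutines); their complexity is the worst-case number of arithmetic operations and tests in $\mathbb F_q$. Matrices over $\mathbb F_{q^2}=\mathbb F_q(\sqrt a)$ ($a$ a non-square) are represented by the coordinates of their entries in the basis $(1,\sqrt a)$. Consider the following algorithm with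 input $Y=(Y_{ij})_{i,j\in\{0,1\}}\in\mathbb F_q^{2m\times 2n}$. For $r$ with $r^2=a$ let $\mathrm{Fold}_r(Y)=\begin{pmatrix} r^{-1}I_m & I_m\end{pmatrix}Y\begin{pmatrix} I_n\\ -r^{-1}I_n\end{pmatrix}$, and let $\mathrm{Part}_r(Y)$ be $Y_{10}-r^{-1}Y_{11}$ if $\mathcal C$ has an erasure decoder for known row spaces, and $Y_{10}+r^{-1}Y_{00}$ if it has one for known column spaces. * If $a$ is a square in $\mathbb F_q$, fix $s\in\mathbb F_q$ with $s^2=a$. Apply the error decoder of $\mathcal D$ to $\mathrm{Fold}_{s}(Y)$ and $\mathrm{Fold}_{-s}(Y)$, obtaining $P_{\pm}=\pm 2s^{-1}B_0+2B_1$ and hence $B_0,B_1$; put $\widetilde Y=Y-\begin{pmatrix}B_0&-aB_1\\B_1&-B_0\end{pmatrix}$; apply the erasure decoder of $\mathcal C$ to $\mathrm{Part}_{\pm s}(\widetilde Y)$ with $W=\mathrm{Fold}_{\pm s}(Y)-P_\pm$, obtaining $A_1\mp s^{-1}A_0$ (rows) or $A_1\pm s^{-1}A_0$ (columns), hence $A_0,A_1$;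 return the corresponding matrix $X$ of the above form and $Y-X$. If a decoder fails, stop with a failure. * If $a$ is not a square in $\mathbb F_q$, do the same with $r=\sqrt a\in\mathbb F_{q^2}$ only, with an error decoder for $\mathcal D\otimes\mathbb F_{q^2}$ and an erasure decoder for $\mathcal C\otimes\mathbb F_{q^2}$, reading off $B_0,B_1$ and $A_0,A_1$ from coordinates in the basis $(1,\sqrt a)$. Then for every $X\in\mathcal C\diamond_a\mathcal D$ and $E$ uniformly random among the $2m\times 2n$ matrices of rank $t$ over $\mathbb F_q$, the following holds on input $Y=X+E$, with absolute implied constants (the same for all $q,m,n,t,a,\mathcal C,\mathcal D$ and all decoders). * If $a$ is a square, and the decoders correct $t$ erasures for $\mathcal C$ and $t$ errors for $\mathcal D$ with complexities at most $C(t)$ and $D(t)$, then the algorithm returns $(X,E)$ with probability $1-\mathcal O(q^{t-\min(m,n)-1})$, and its complexity is at most $\mathcal O(mn)+2(C(t)+D(t))$ operations in $\mathbb F_q$. * If $a$ is not a square, and the decoders correct $t$ erasures for $\mathcal C\otimes\mathbb F_{q^2}$ and $t$ errors for $\mathcal D\otimes\mathbb F_{q^2}$ with complexities at most $C(t)$ and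 $D(t)$ operations in $\mathbb F_q$, then the algorithm returns $(X,E)$ with probability $1-\mathcal O(q^{2t-2\min(m,n)-2})$, and its complexity is at most $\mathcal O(mn)+C(t)+D(t)$ operations in $\mathbb F_q$. -/

import Mathlib

universe u

namespace RankPlotkin

/-! ### Matrix rank metric codes and the Plotkin construction -/

/-- The `2m × 2n` matrices, seen as `2 × 2` block matrices with blocks of size `m × n`. -/
abbrev BlockMat (m n : ℕ) (F : Type u) : Type u :=
  Matrix (Fin m ⊕ Fin m) (Fin n ⊕ Fin n) F

/-- The Plotkin construction of two `F`-linear matrix codes `C`, `D` of size `m × n`: the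
`F`-linear code of all `[[A₀ + B₀, a (A₁ - B₁)], [A₁ + B₁, A₀ - B₀]]`, `Aᵢ ∈ C`, `Bᵢ ∈ D`. -/
def plotkin {F : Type u} [Field F] {m n : ℕ} (a : F)
    (C D : Submodule F (Matrix (Fin m) (Fin n) F)) : Submodule F (BlockMat m n F) where
  carrier := {X | ∃ A₀ ∈ C, ∃ A₁ ∈ C, ∃ B₀ ∈ D, ∃ B₁ ∈ D,
    X = Matrix.fromBlocks (A₀ + B₀) (a • (A₁ - B₁)) (A₁ + B₁) (A₀ - B₀)}
  zero_mem' := ⟨0, C.zero_mem, 0, C.zero_mem, 0, D.zero_mem, 0, D.zero_mem, by simp⟩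
  add_mem' := by
    rintro _ _ ⟨A₀, hA₀, A₁, hA₁, B₀, hB₀, B₁, hB₁, rfl⟩ ⟨A₀', hA₀', A₁', hA₁', B₀', hB₀', B₁', hB₁', rfl⟩
    refine ⟨A₀ + A₀', C.add_mem hA₀ hA₀', A₁ + A₁', C.add_mem hA₁ hA₁',
      B₀ + B₀', D.add_mem hB₀ hB₀', B₁ + B₁', D.add_mem hB₁ hB₁', ?_⟩
    rw [Matrix.fromBlocks_add, ← smul_add]
    congr 1
    · abel
    · congr 1; abel
    · abel
    · abel
  smul_mem' := by
    rintro c _ ⟨A₀, hA₀, A₁, hA₁, B₀, hB₀, B₁, hB₁, rfl⟩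
    refine ⟨c • A₀, C.smul_mem c hA₀, c • A₁, C.smul_mem c hA₁,
      c • B₀, D.smul_mem c hB₀, c • B₁, D.smul_mem c hB₁, ?_⟩
    rw [Matrix.fromBlocks_smul, smul_comm c a]
    simp only [smul_add, smul_sub]

/-- The quadratic extension `F(√a) = F[x]/(x² - a)` of `F`. If `F` has `q` elements and `a` is not
a square in `F`, this is the field with `q²` elements. The element `x + y √a` is `⟨x, y⟩`. -/
abbrev QuadExt {F : Type u} (a : F) [Zero F] : Type u := QuadraticAlgebra F a 0

/-- The code `C ⊗ F(√a)`: the `F(√a)`-span of `C` among the matrices over `F(√a)`. -/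
def extendScalars {F : Type u} [Field F] {m n : ℕ} (a : F)
    (C : Submodule F (Matrix (Fin m) (Fin n) F)) :
    Submodule (QuadExt a) (Matrix (Fin m) (Fin n) (QuadExt a)) :=
  Submodule.span (QuadExt a)
    ((fun M : Matrix (Fin m) (Fin n) F => M.map (algebraMap F (QuadExt a))) '' (C : Set _))

/-! ### Decoding problems -/

/-- `dec` corrects `t` errors for the code `D`. -/
def CorrectsErrors {L : Type u} [CommRing L] {m n : ℕ}
    (D : Submodule L (Matrix (Fin m) (Fin n) L)) (t : ℕ)
    (dec : Matrix (Fin m) (Fin n) L → Option (Matrix (Fin m) (Fin n) L)) : Prop :=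
  ∀ X ∈ D, ∀ E : Matrix (Fin m) (Fin n) L, E.rank ≤ t → dec (X + E) = some X

/-- Which of the two spaces attached to an error matrix is known to an erasure decoder. -/
inductive Side : Type
  | row : Side
  | col : Side

/-- The row space (resp. column space) of `E` is contained in that of `W`. -/
def SpaceLE {L : Type u} [CommRing L] {m n : ℕ} : Side → (E W : Matrix (Fin m) (Fin n) L) → Prop
  | .row, E, W => Submodule.span L (Set.range E.row) ≤ Submodule.span L (Set.range W.row)
  | .col, E, W => Submodule.span L (Set.range E.col) ≤ Submodule.span L (Set.range W.col)

/-- `dec` corrects `t` erasures for the code `C`, i.e. errors whose row space (resp. column space)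
is contained in a known space of dimension `t`. The known space is given to the decoder as the row
space (resp. column space) of a matrix `W`. -/
def CorrectsErasures {L : Type u} [CommRing L] {m n : ℕ} (side : Side)
    (C : Submodule L (Matrix (Fin m) (Fin n) L)) (t : ℕ)
    (dec : Matrix (Fin m) (Fin n) L → Matrix (Fin m) (Fin n) L →
      Option (Matrix (Fin m) (Fin n) L)) : Prop :=
  ∀ X ∈ C, ∀ E W : Matrix (Fin m) (Fin n) L, W.rank = t → SpaceLE side E W →
    dec (X + E) W = some X

/-! ### Algorithms over `F` and their number of operations in `F` -/

/-- Arithmetic expressions over `F` in the variables `V`. -/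
inductive Expr (F : Type u) (V : Type) : Type u
  | var (v : V) : Expr F V
  | const (c : F) : Expr F V
  | add (e e' : Expr F V) : Expr F V
  | sub (e e' : Expr F V) : Expr F V
  | mul (e e' : Expr F V) : Expr F V
  | div (e e' : Expr F V) : Expr F V

namespace Expr

variable {F : Type u} {V : Type}

instance : Add (Expr F V) := ⟨.add⟩
instance : Sub (Expr F V) := ⟨.sub⟩
instance : Mul (Expr F V) := ⟨.mul⟩

/-- The value of an expression (with the convention `x / 0 = 0`). -/
def eval [Field F] : Expr F V → (V → F) → F
  | .var v, ρ => ρ v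
  | .const c, _ => c
  | .add e e', ρ => e.eval ρ + e'.eval ρ
  | .sub e e', ρ => e.eval ρ - e'.eval ρ
  | .mul e e', ρ => e.eval ρ * e'.eval ρ
  | .div e e', ρ => e.eval ρ / e'.eval ρ

/-- The number of arithmetic operations in an expression. -/
def ops : Expr F V → ℕ
  | .var _ => 0
  | .const _ => 0
  | .add e e' => e.ops + e'.ops + 1
  | .sub e e' => e.ops + e'.ops + 1
  | .mul e e' => e.ops + e'.ops + 1
  | .div e e' => e.ops + e'.ops + 1

end Expr

/-- Algorithms over `F` (algebraic computation trees with subroutine calls), with input variables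
`V` and outputs indexed by `κ`. Field elements are only accessible through arithmetic operations
and tests for zero. -/
inductive Prog (F : Type u) : Type → Type → Type (max u 1)
  /-- return the values of the given variables -/
  | ret {V κ : Type} (out : κ → V) : Prog F V κ
  /-- stop with a decoding failure -/
  | fail {V κ : Type} : Prog F V κ
  /-- compute the values of finitely many expressions, which become new variables, and go on -/
  | block {V κ ι : Type} [Fintype ι] (e : ι → Expr F V) (k : Prog F (V ⊕ ι) κ) : Prog F V κ
  /-- go on with `p` if the variable `v` is zero, and with `p'` otherwise -/
  | ifZero {V κ : Type} (v : V) (p p' : Prog F V κ) : Prog F V κ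
  /-- run a subroutine; its outputs become new variables; a failure of it is a failure of all -/
  | call {V κ I O : Type} (sub : Prog F I O) (inp : I → V) (k : Prog F (V ⊕ O) κ) : Prog F V κ

namespace Prog

variable {F : Type u} [Field F] [DecidableEq F]

/-- The output of an algorithm on an input; `none` is a decoding failure. -/
def eval : {V κ : Type} → Prog F V κ → (V → F) → Option (κ → F)
  | _, _, .ret out, ρ => some fun k => ρ (out k)
  | _, _, .fail, _ => none
  | _, _, @block _ _ _ _ _ e k, ρ => k.eval (Sum.elim ρ fun i => (e i).eval ρ)
  | _, _, .ifZero v p p', ρ => if ρ v = 0 then p.eval ρ else p'.eval ρ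
  | _, _, .call sub inp k, ρ =>
    match sub.eval fun i => ρ (inp i) with
    | none => none
    | some out => k.eval (Sum.elim ρ out)

/-- The number of operations in `F` (arithmetic operations and tests for zero, including those made
by the subroutines) of an algorithm on an input. -/
def time : {V κ : Type} → Prog F V κ → (V → F) → ℕ
  | _, _, .ret _, _ => 0
  | _, _, .fail, _ => 0
  | _, _, @block _ _ _ _ _ e k, ρ => (∑ i, (e i).ops) + k.time (Sum.elim ρ fun i => (e i).eval ρ)
  | _, _, .ifZero v p p', ρ => 1 + if ρ v = 0 then p.time ρ else p'.time ρ
  | _, _, .call sub inp k, ρ =>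
    (sub.time fun i => ρ (inp i)) +
      match sub.eval fun i => ρ (inp i) with
      | none => 0
      | some out => k.time (Sum.elim ρ out)

/-- The (worst case) complexity of `p` is at most `c` operations in `F`. -/
def CostAtMost {V κ : Type} (p : Prog F V κ) (c : ℕ) : Prop :=
  ∀ ρ : V → F, p.time ρ ≤ c

end Prog

/-! ### Matrices as inputs and outputs of algorithms -/

/-- Positions in an `m × n` matrix. -/
abbrev Idx (m n : ℕ) : Type := Fin m × Fin n

/-- Positions in a `2m × 2n` matrix, seen as a block matrix. -/
abbrev BIdx (m n : ℕ) : Type := (Fin m ⊕ Fin m) × (Fin n ⊕ Fin n)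

/-- Coordinates of an `m × n` matrix over `F(√a)`: two elements of `F` for each entry, namely its
coordinates in the basis `(1, √a)`. -/
abbrev QIdx (m n : ℕ) : Type := Idx m n × Fin 2

section Encoding

variable {F : Type u} {ι κ : Type}

/-- A matrix as the list of its entries. -/
def enc (M : Matrix ι κ F) : ι × κ → F := fun p => M p.1 p.2

/-- The matrix with the given entries. -/
def unenc (x : ι × κ → F) : Matrix ι κ F := Matrix.of fun i j => x (i, j)

variable [Zero F] {a : F}

/-- A matrix over `F(√a)` as the list of the coordinates of its entries. -/
def encQ (M : Matrix ι κ (QuadExt a)) : (ι × κ) × Fin 2 → F :=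
  fun p => ![(M p.1.1 p.1.2).re, (M p.1.1 p.1.2).im] p.2

/-- The matrix over `F(√a)` with the given coordinates of its entries. -/
def unencQ (x : (ι × κ) × Fin 2 → F) : Matrix ι κ (QuadExt a) :=
  Matrix.of fun i j => ⟨x ((i, j), 0), x ((i, j), 1)⟩

end Encoding

section Decoders

variable {F : Type u} [Field F] [DecidableEq F] {m n : ℕ}

/-- The map computed by an algorithm for decoding errors over `F`. -/
def errorDec (p : Prog F (Idx m n) (Idx m n)) (Y : Matrix (Fin m) (Fin n) F) :
    Option (Matrix (Fin m) (Fin n) F) :=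
  (p.eval (enc Y)).map unenc

/-- The map computed by an algorithm for decoding erasures over `F`. -/
def erasureDec (p : Prog F (Idx m n ⊕ Idx m n) (Idx m n)) (Y W : Matrix (Fin m) (Fin n) F) :
    Option (Matrix (Fin m) (Fin n) F) :=
  (p.eval (Sum.elim (enc Y) (enc W))).map unenc

/-- The map computed by an algorithm for decoding errors over `F(√a)`. -/
def errorDecQ {a : F} (p : Prog F (QIdx m n) (QIdx m n)) (Y : Matrix (Fin m) (Fin n) (QuadExt a)) :
    Option (Matrix (Fin m) (Fin n) (QuadExt a)) :=
  (p.eval (encQ Y)).map unencQ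

/-- The map computed by an algorithm for decoding erasures over `F(√a)`. -/
def erasureDecQ {a : F} (p : Prog F (QIdx m n ⊕ QIdx m n) (QIdx m n))
    (Y W : Matrix (Fin m) (Fin n) (QuadExt a)) : Option (Matrix (Fin m) (Fin n) (QuadExt a)) :=
  (p.eval (Sum.elim (encQ Y) (encQ W))).map unencQ

/-- The map computed by an algorithm that takes a `2m × 2n` matrix and returns two of them. -/
def pairDec (p : Prog F (BIdx m n) (BIdx m n ⊕ BIdx m n)) (Y : BlockMat m n F) :
    Option (BlockMat m n F × BlockMat m n F) :=
  (p.eval (enc Y)).map fun out =>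
    (unenc fun k => out (Sum.inl k), unenc fun k => out (Sum.inr k))

end Decoders

/-! ### The decoding algorithm for the Plotkin construction -/

section Algorithm

variable {F : Type u} [Field F] {V : Type} {m n : ℕ}

/-- The matrix `Y - [[B₀, -a B₁], [B₁, -B₀]]`, as expressions. -/
def removeB (a : F) (Y : BIdx m n → Expr F V) (B₀ B₁ : Idx m n → Expr F V) :
    BIdx m n → Expr F V
  | (.inl i, .inl j) => Y (.inl i, .inl j) - B₀ (i, j)
  | (.inl i, .inr j) => Y (.inl i, .inr j) + .const a * B₁ (i, j)
  | (.inr i, .inl j) => Y (.inr i, .inl j) - B₁ (i, j)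
  | (.inr i, .inr j) => Y (.inr i, .inr j) + B₀ (i, j)

/-- The matrix `[[A₀ + B₀, a (A₁ - B₁)], [A₁ + B₁, A₀ - B₀]]`, as expressions. -/
def codeword (a : F) (A₀ A₁ B₀ B₁ : Idx m n → Expr F V) : BIdx m n → Expr F V
  | (.inl i, .inl j) => A₀ (i, j) + B₀ (i, j)
  | (.inl i, .inr j) => .const a * (A₁ (i, j) - B₁ (i, j))
  | (.inr i, .inl j) => A₁ (i, j) + B₁ (i, j)
  | (.inr i, .inr j) => A₀ (i, j) - B₀ (i, j)

/-- The folding `(r⁻¹ I  I) Y (I ; -r⁻¹ I)`, as expressions. -/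
def fold (r : F) (Y : BIdx m n → Expr F V) : Idx m n → Expr F V
  | (i, j) => .const r⁻¹ * Y (.inl i, .inl j) + Y (.inr i, .inl j)
      - .const (r⁻¹ * r⁻¹) * Y (.inl i, .inr j) - .const r⁻¹ * Y (.inr i, .inr j)

/-- The part of a partial folding of `Y` that is handed to the erasure decoder, as expressions:
the bottom half of `Y (I ; -r⁻¹ I)` if row spaces are known, and the left half of `(r⁻¹ I  I) Y` if
column spaces are known. -/
def partialFold (r : F) (Y : BIdx m n → Expr F V) : Side → Idx m n → Expr F V
  | .row, (i, j) => Y (.inr i, .inl j) - .const r⁻¹ * Y (.inr i, .inr j)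
  | .col, (i, j) => Y (.inr i, .inl j) + .const r⁻¹ * Y (.inl i, .inl j)

/-- The sign `ε` such that the partial folding with parameter `r` of `[[A₀, a A₁], [A₁, A₀]]` is
`A₁ + ε r⁻¹ A₀`. -/
def sign (F : Type u) [Field F] : Side → F
  | .row => -1
  | .col => 1

/-- The decoding algorithm when `a = s²` is a square in `F`, with the given subroutines for
decoding errors for `D` and erasures for `C`.
1. Compute the foldings `Y₊`, `Y₋` with the parameters `s` and `-s`.
2. Decode them with the error decoder to `P₊ = 2 s⁻¹ B₀ + 2 B₁` and `P₋ = -2 s⁻¹ B₀ + 2 B₁`.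
3. Remove `B₀, B₁` from `Y`, compute the two partial foldings, and the folded errors `Y₊ - P₊`,
   `Y₋ - P₋`, whose row (or column) spaces are given to the erasure decoder.
4. Decode the two partial foldings to `R₊ = A₁ + ε s⁻¹ A₀` and `R₋ = A₁ - ε s⁻¹ A₀`.
5. Return the codeword and its difference to `Y`. -/
def decodeSquare (side : Side) (s : F) (decD : Prog F (Idx m n) (Idx m n))
    (decC : Prog F (Idx m n ⊕ Idx m n) (Idx m n)) :
    Prog F (BIdx m n) (BIdx m n ⊕ BIdx m n) :=
  .block (ι := Idx m n ⊕ Idx m n)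
    (Sum.elim (fold s fun k => .var k) (fold (-s) fun k => .var k)) <|
  .call decD (fun p => .inr (.inl p)) <|
  .call decD (fun p => .inl (.inr (.inr p))) <|
  .block (ι := (Idx m n ⊕ Idx m n) ⊕ (Idx m n ⊕ Idx m n))
    (let Y := fun k => .var (.inl (.inl (.inl k)))
     let Yp := fun p => .var (.inl (.inl (.inr (.inl p))))
     let Ym := fun p => .var (.inl (.inl (.inr (.inr p))))
     let Pp := fun p => .var (.inl (.inr p))
     let Pm := fun p => .var (.inr p)
     let B₀ := fun p => .const (s / 4) * (Pp p - Pm p)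
     let B₁ := fun p => .const (1 / 4) * (Pp p + Pm p)
     let Y' := removeB (s * s) Y B₀ B₁
     Sum.elim
       (Sum.elim (partialFold s Y' side) (fun p => Yp p - Pp p))
       (Sum.elim (partialFold (-s) Y' side) (fun p => Ym p - Pm p))) <|
  .call decC (fun p => .inr (.inl p)) <|
  .call decC (fun p => .inl (.inr (.inr p))) <|
  .block (ι := BIdx m n)
    (let Pp := fun p => .var (.inl (.inl (.inl (.inl (.inr p)))))
     let Pm := fun p => .var (.inl (.inl (.inl (.inr p))))
     let Rp := fun p => .var (.inl (.inr p))
     let Rm := fun p => .var (.inr p)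
     let B₀ := fun p => .const (s / 4) * (Pp p - Pm p)
     let B₁ := fun p => .const (1 / 4) * (Pp p + Pm p)
     let A₀ := fun p => .const (sign F side * s / 2) * (Rp p - Rm p)
     let A₁ := fun p => .const (1 / 2) * (Rp p + Rm p)
     codeword (s * s) A₀ A₁ B₀ B₁) <|
  .block (ι := BIdx m n)
    (fun k => .var (.inl (.inl (.inl (.inl (.inl (.inl (.inl k))))))) - .var (.inr k)) <|
  .ret (Sum.elim (fun k => .inl (.inr k)) (fun k => .inr k))

/-- The coordinates in the basis `(1, √a)` of the folding `((√a)⁻¹ I  I) Y (I ; -(√a)⁻¹ I)` of a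
matrix `Y` with entries in `F`, as expressions; note that `(√a)⁻¹ = a⁻¹ √a`. -/
def foldQ (a : F) (Y : BIdx m n → Expr F V) : QIdx m n → Expr F V
  | ((i, j), 0) => Y (.inr i, .inl j) - .const a⁻¹ * Y (.inl i, .inr j)
  | ((i, j), 1) => .const a⁻¹ * (Y (.inl i, .inl j) - Y (.inr i, .inr j))

/-- The coordinates in the basis `(1, √a)` of the bottom half of `Y (I ; -(√a)⁻¹ I)` if row spaces
are known, and of the left half of `((√a)⁻¹ I  I) Y` if column spaces are known. -/
def partialFoldQ (a : F) (Y : BIdx m n → Expr F V) : Side → QIdx m n → Expr F V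
  | .row, ((i, j), 0) => Y (.inr i, .inl j)
  | .row, ((i, j), 1) => .const (-a⁻¹) * Y (.inr i, .inr j)
  | .col, ((i, j), 0) => Y (.inr i, .inl j)
  | .col, ((i, j), 1) => .const a⁻¹ * Y (.inl i, .inl j)

/-- The decoding algorithm when `a` is not a square in `F`, with the given subroutines for
decoding errors for `D ⊗ F(√a)` and erasures for `C ⊗ F(√a)`.
1. Compute the folding of `Y` over `F(√a)`.
2. Decode it with the error decoder to `P = 2 (√a)⁻¹ B₀ + 2 B₁`, which gives `B₀` and `B₁`.
3. Remove `B₀, B₁` from `Y`, compute the partial folding and the folded error, whose row (or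
   column) space is given to the erasure decoder.
4. Decode the partial folding to `R = A₁ + ε (√a)⁻¹ A₀`, which gives `A₀` and `A₁`.
5. Return the codeword and its difference to `Y`. -/
def decodeNonsquare (side : Side) (a : F) (decD : Prog F (QIdx m n) (QIdx m n))
    (decC : Prog F (QIdx m n ⊕ QIdx m n) (QIdx m n)) :
    Prog F (BIdx m n) (BIdx m n ⊕ BIdx m n) :=
  .block (ι := QIdx m n) (foldQ a fun k => .var k) <|
  .call decD (fun p => .inr p) <|
  .block (ι := QIdx m n ⊕ QIdx m n)
    (let Y := fun k => .var (.inl (.inl k))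
     let B₀ := fun p => .const (a / 2) * .var (.inr (p, 1))
     let B₁ := fun p => .const (1 / 2) * .var (.inr (p, 0))
     Sum.elim (partialFoldQ a (removeB a Y B₀ B₁) side)
       (fun p => .var (.inl (.inr p)) - .var (.inr p))) <|
  .call decC (fun p => .inr p) <|
  .block (ι := BIdx m n)
    (let B₀ := fun p => .const (a / 2) * .var (.inl (.inl (.inr (p, 1))))
     let B₁ := fun p => .const (1 / 2) * .var (.inl (.inl (.inr (p, 0))))
     let A₀ := fun p => .const (sign F side * a) * .var (.inr (p, 1))
     let A₁ := fun p => .var (.inr (p, 0))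
     codeword a A₀ A₁ B₀ B₁) <|
  .block (ι := BIdx m n)
    (fun k => .var (.inl (.inl (.inl (.inl (.inl k))))) - .var (.inr k)) <|
  .ret (Sum.elim (fun k => .inl (.inr k)) (fun k => .inr k))

end Algorithm

/-! ### Probability of success -/

/-- The probability that an algorithm that gets `X + E`, where `E` is uniformly random among the
`2m × 2n` matrices of rank `t` over the finite field `F`, returns the pair `(X, E)`. -/
noncomputable def successProb {F : Type u} [Field F] [DecidableEq F] {m n : ℕ}
    (p : Prog F (BIdx m n) (BIdx m n ⊕ BIdx m n)) (t : ℕ) (X : BlockMat m n F) : ℝ :=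
  ({E : BlockMat m n F | E.rank = t ∧ pairDec p (X + E) = some (X, E)}.ncard : ℝ) /
    ({E : BlockMat m n F | E.rank = t}.ncard : ℝ)

end RankPlotkin

open RankPlotkin

/-! Let `ρ = r⁻¹` with `r² = a`. Because `ρ² a = 1`, folding kills the `A`-part of a codeword and
leaves `2 ρ B₀ + 2 B₁` (`foldMat_codeword`). Folding cannot increase the rank, so the folded error
always lies within the radius of the error decoder, and `B₀`, `B₁` are recovered without any
assumption on `E`. Since `2` is invertible, the two roots `r = ±s`, or the two coordinates over
`F(√a)`, separate `B₀` from `B₁`, and later `A₀` from `A₁`.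

Once `B₀`, `B₁` are removed, the partial folding is `A₁ ± ρ A₀` plus the partial folding of `E`, and
`W` is the full folding of `E`. If `W` still has rank `t`, its row (column) space contains that of
the partially folded error (`spaceLE_partMat_foldMat`), and the erasure decoder succeeds. Hence the
algorithm can fail only if some folding used lowers the rank of `E`. This requires the column space
of `E` to meet `{(x, -ρ x)}`, or its row space to meet `{(y, ρ⁻¹ y)}`, nontrivially
(`rank_foldMat_eq`).

These events are rare. Invertible row operations permute the matrices of rank `t`, so the number of
them whose column space contains `k` given independent vectors does not depend on the vectors, and
double counting gives it (`card_filter_mem_range_mul`). A union bound with `k = 1` yields `2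
q^(t-m-1)` (`card_badSet_le`). In the nonsquare case, a vector of the kernel over `F(√a)` amounts to
a pair `z, J z` over `F`, where `J²` is a nonsquare scalar; `k = 2` yields `4 q^(2t-2m-2)`
(`card_badSetQ_le`). Row spaces are handled by transposition. The complexity bound counts the
operations in each block. -/

namespace RankPlotkin

/-! ### Linear algebra -/

section Rank

variable {L : Type*} [Field L] {ι κ μ ν : Type*} [Fintype ι] [Fintype κ]

/-- A finite linearly independent family can be moved to any other one by an automorphism. -/
theorem exists_linearEquiv_apply_eq {V : Type*} [AddCommGroup V] [Module L V]
    [FiniteDimensional L V] {v w : κ → V} (hv : LinearIndependent L v)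
    (hw : LinearIndependent L w) : ∃ e : V ≃ₗ[L] V, ∀ i, e (v i) = w i := by
  classical
  have : Fintype (Module.Basis.sumExtendIndex hv) := by
    have := Module.Finite.finite_basis (Module.Basis.sumExtend hv)
    have : Finite (Module.Basis.sumExtendIndex hv) := Finite.sum_right κ
    exact Fintype.ofFinite _
  have : Fintype (Module.Basis.sumExtendIndex hw) := by
    have := Module.Finite.finite_basis (Module.Basis.sumExtend hw)
    have : Finite (Module.Basis.sumExtendIndex hw) := Finite.sum_right κ
    exact Fintype.ofFinite _
  -- Both families extend to bases, and each extension adds `dim V - |κ|` vectors, so the added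
  -- vectors can be matched.
  have hc : Fintype.card (Module.Basis.sumExtendIndex hv) =
      Fintype.card (Module.Basis.sumExtendIndex hw) := by
    have h1 := Module.finrank_eq_card_basis (Module.Basis.sumExtend hv)
    have h2 := Module.finrank_eq_card_basis (Module.Basis.sumExtend hw)
    rw [Fintype.card_sum] at h1 h2
    omega
  refine ⟨(Module.Basis.sumExtend hv).equiv (Module.Basis.sumExtend hw)
    (Equiv.sumCongr (Equiv.refl κ) (Fintype.equivOfCardEq hc)), fun i => ?_⟩
  have h1 : Module.Basis.sumExtend hv (Sum.inl i) = v i := by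
    simp only [Module.Basis.sumExtend, Module.Basis.reindex_apply, Module.Basis.extend_apply_self]
    rfl
  have h2 : Module.Basis.sumExtend hw (Sum.inl i) = w i := by
    simp only [Module.Basis.sumExtend, Module.Basis.reindex_apply, Module.Basis.extend_apply_self]
    rfl
  rw [← h1, Module.Basis.equiv_apply]
  simpa using h2

/-- Left multiplication by a matrix that is injective on the column space preserves the rank. -/
theorem rank_mul_eq_right_of_injOn (P : Matrix μ ι L) (E : Matrix ι κ L)
    (h : ∀ v, P.mulVec (E.mulVec v) = 0 → E.mulVec v = 0) : (P * E).rank = E.rank := by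
  -- Injectivity on the column space says that `P * E` and `E` have the same kernel; rank-nullity
  -- concludes.
  have hker : LinearMap.ker (P * E).mulVecLin = LinearMap.ker E.mulVecLin := by
    ext v
    simp only [LinearMap.mem_ker, Matrix.mulVecLin_apply, ← Matrix.mulVec_mulVec]
    exact ⟨h v, fun hv => by rw [hv, Matrix.mulVec_zero]⟩
  have h1 := LinearMap.finrank_range_add_finrank_ker (P * E).mulVecLin
  have h2 := LinearMap.finrank_range_add_finrank_ker E.mulVecLin
  rw [hker] at h1
  unfold Matrix.rank
  omega

/-- Multiplication on both sides by matrices that are injective on the column space and on the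
row space preserves the rank. -/
theorem rank_mul_mul_eq_of_injOn [Fintype μ] [Fintype ν] (P : Matrix μ ι L) (E : Matrix ι κ L)
    (Q : Matrix κ ν L)
    (hP : ∀ v, P.mulVec (E.mulVec v) = 0 → E.mulVec v = 0)
    (hQ : ∀ v, Q.transpose.mulVec (E.transpose.mulVec v) = 0 → E.transpose.mulVec v = 0) :
    (P * E * Q).rank = E.rank := by
  rw [← Matrix.rank_transpose, Matrix.transpose_mul, rank_mul_eq_right_of_injOn,
    Matrix.rank_transpose, rank_mul_eq_right_of_injOn P E hP]
  intro v hv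
  rw [Matrix.transpose_mul, ← Matrix.mulVec_mulVec] at hv ⊢
  exact hQ _ hv

theorem span_range_row_mul_le {κ : Type*} (P : Matrix μ ι L) (E : Matrix ι κ L) :
    Submodule.span L (Set.range (P * E).row) ≤ Submodule.span L (Set.range E.row) := by
  rw [Submodule.span_le]
  rintro _ ⟨i, rfl⟩
  have : (P * E).row i = ∑ j, P i j • E.row j := by
    ext k
    simp [Matrix.mul_apply]
  rw [this]
  exact Submodule.sum_mem _ fun j _ =>
    Submodule.smul_mem _ _ (Submodule.subset_span (Set.mem_range_self j))

/-- If `P` does not decrease the rank of `G`, then the row space of `P * G` contains that of any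
`S * G`. -/
theorem span_range_row_le_of_rank_le [Fintype μ] (P : Matrix μ ι L) (S : Matrix ν ι L)
    (G : Matrix ι κ L)
    (h : G.rank ≤ (P * G).rank) :
    Submodule.span L (Set.range (S * G).row) ≤ Submodule.span L (Set.range (P * G).row) := by
  -- The row space of `P * G` lies in that of `G` and has at least its dimension, so the two
  -- coincide.
  have := Submodule.eq_of_le_of_finrank_le (span_range_row_mul_le P G) (by
    rwa [← Matrix.rank_eq_finrank_span_row, ← Matrix.rank_eq_finrank_span_row])
  rw [this]
  exact span_range_row_mul_le S G

/-- If `Q` does not decrease the rank of `G`, then the column space of `G * Q` contains that of any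
`G * S`. -/
theorem span_range_col_le_of_rank_le [Fintype μ] (G : Matrix ι κ L) (Q : Matrix κ μ L)
    (S : Matrix κ ν L)
    (h : G.rank ≤ (G * Q).rank) :
    Submodule.span L (Set.range (G * S).col) ≤ Submodule.span L (Set.range (G * Q).col) := by
  have := span_range_row_le_of_rank_le Q.transpose S.transpose G.transpose (by
    rwa [← Matrix.transpose_mul, Matrix.rank_transpose, Matrix.rank_transpose])
  rwa [← Matrix.transpose_mul, ← Matrix.transpose_mul] at this

/-- A partial identity matrix serves: it is a product of two submatrices of identities with
one-sided inverses. This makes the denominator of the success probability nonzero. -/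
theorem exists_rank_eq {t : ℕ} (hι : t ≤ Fintype.card ι) (hκ : t ≤ Fintype.card κ) :
    ∃ E : Matrix ι κ L, E.rank = t := by
  classical
  obtain ⟨f⟩ := Function.Embedding.nonempty_of_card_le (α := Fin t) (β := ι) (by simpa using hι)
  obtain ⟨g⟩ := Function.Embedding.nonempty_of_card_le (α := Fin t) (β := κ) (by simpa using hκ)
  set A : Matrix ι (Fin t) L := (1 : Matrix ι ι L).submatrix id f
  set B : Matrix (Fin t) κ L := (1 : Matrix κ κ L).submatrix g id
  have hA : A.transpose * A = 1 := by
    ext i j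
    simp [A, Matrix.mul_apply, Matrix.one_apply, f.injective.eq_iff]
  have hB : B * B.transpose = 1 := by
    ext i j
    simp [B, Matrix.mul_apply, Matrix.one_apply, g.injective.eq_iff, eq_comm]
  refine ⟨A * B, le_antisymm ?_ ?_⟩
  · exact (Matrix.rank_mul_le_left A B).trans ((Matrix.rank_le_card_width A).trans (by simp))
  · have h : A.transpose * (A * B) * B.transpose = 1 := by
      rw [← Matrix.mul_assoc, hA, Matrix.one_mul, hB]
    calc t = (A.transpose * (A * B) * B.transpose).rank := by rw [h, Matrix.rank_one]; simp
      _ ≤ (A.transpose * (A * B)).rank := Matrix.rank_mul_le_left _ _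
      _ ≤ (A * B).rank := Matrix.rank_mul_le_right _ _

end Rank

/-! ### Counting matrices of given rank -/

section Count

open scoped Classical in
/-- The matrices of rank `t`. -/
noncomputable def rankSet (F : Type*) [Field F] [Fintype F] (ι κ : Type*) [Fintype ι] [Fintype κ]
    (t : ℕ) : Finset (Matrix ι κ F) :=
  Finset.univ.filter fun E => E.rank = t

variable {F : Type*} [Field F] [Fintype F] {ι κ : Type*} [Fintype ι] [Fintype κ]

@[simp]
theorem mem_rankSet {t : ℕ} {E : Matrix ι κ F} : E ∈ rankSet F ι κ t ↔ E.rank = t := by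
  simp [rankSet]

open scoped Classical in
/-- For a linearly independent family, the number of rank `t` matrices whose column space contains
it does not depend on the family. -/
theorem card_filter_mem_range_eq {k t : ℕ} {v w : Fin k → ι → F} (hv : LinearIndependent F v)
    (hw : LinearIndependent F w) :
    ((rankSet F ι κ t).filter fun E => ∀ i, v i ∈ LinearMap.range E.mulVecLin).card =
      ((rankSet F ι κ t).filter fun E => ∀ i, w i ∈ LinearMap.range E.mulVecLin).card := by
  obtain ⟨e, he⟩ := exists_linearEquiv_apply_eq hv hw
  -- Left multiplication by the matrix of `e` preserves the rank and moves column spaces by `e`; its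
  -- inverse is left multiplication by `P'`.
  set P : Matrix ι ι F := LinearMap.toMatrix' e.toLinearMap
  set P' : Matrix ι ι F := LinearMap.toMatrix' e.symm.toLinearMap
  have hP (x : ι → F) : P.mulVec x = e x := by
    rw [← Matrix.toLin'_apply, Matrix.toLin'_toMatrix']; rfl
  have hP' (x : ι → F) : P'.mulVec x = e.symm x := by
    rw [← Matrix.toLin'_apply, Matrix.toLin'_toMatrix']; rfl
  have h1 : P * P' = 1 := by
    rw [← LinearMap.toMatrix'_mul]; simp [← LinearMap.toMatrix'_one]
    ext; simp
  have h2 : P' * P = 1 := mul_eq_one_comm.1 h1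
  have hr (E : Matrix ι κ F) : (P * E).rank = E.rank :=
    rank_mul_eq_right_of_injOn P E fun v hv => by simpa [hP] using hv
  have hr' (E : Matrix ι κ F) : (P' * E).rank = E.rank :=
    rank_mul_eq_right_of_injOn P' E fun v hv => by simpa [hP'] using hv
  refine Finset.card_bij' (fun E _ => P * E) (fun E _ => P' * E) ?_ ?_ ?_ ?_
  · intro E hE
    simp only [Finset.mem_filter, mem_rankSet, LinearMap.mem_range, Matrix.mulVecLin_apply] at hE ⊢
    refine ⟨by rw [hr, hE.1], fun i => ?_⟩
    obtain ⟨x, hx⟩ := hE.2 i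
    exact ⟨x, by rw [← Matrix.mulVec_mulVec, hx, hP, he]⟩
  · intro E hE
    simp only [Finset.mem_filter, mem_rankSet, LinearMap.mem_range, Matrix.mulVecLin_apply] at hE ⊢
    refine ⟨by rw [hr', hE.1], fun i => ?_⟩
    obtain ⟨x, hx⟩ := hE.2 i
    exact ⟨x, by rw [← Matrix.mulVec_mulVec, hx, hP', ← he, e.symm_apply_apply]⟩
  · intro E _
    rw [← Matrix.mul_assoc, h2, Matrix.one_mul]
  · intro E _
    rw [← Matrix.mul_assoc, h1, Matrix.one_mul]

open scoped Classical in
theorem card_linearIndependent_in_submodule {V : Type*} [AddCommGroup V] [Module F V] [Fintype V]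
    (U : Submodule F V) (k : ℕ) :
    (Finset.univ.filter fun v : Fin k → V => LinearIndependent F v ∧ ∀ i, v i ∈ U).card =
      ∏ i : Fin k, (Fintype.card F ^ Module.finrank F U - Fintype.card F ^ i.val) := by
  have hfin : Module.Finite F V := Module.Finite.of_finite
  rcases le_or_gt k (Module.finrank F U) with hk | hk
  · rw [← card_linearIndependent (K := F) (V := U) hk, Nat.card_eq_fintype_card,
      ← Finset.card_univ]
    symm
    refine Finset.card_bij (fun v _ i => (v.1 i : V)) ?_ ?_ ?_
    · intro v _
      simp only [Finset.mem_filter, Finset.mem_univ, true_and, SetLike.coe_mem, implies_true,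
        and_true]
      exact v.2.map' U.subtype U.ker_subtype
    · intro v _ w _ h
      ext i
      exact congrFun h i
    · intro v hv
      simp only [Finset.mem_filter, Finset.mem_univ, true_and] at hv
      refine ⟨⟨fun i => ⟨v i, hv.2 i⟩, ?_⟩, Finset.mem_univ _, rfl⟩
      exact LinearIndependent.of_comp U.subtype hv.1
  -- For `k > dim U` both sides vanish: the factor with index `dim U` is zero, and `U` contains no
  -- such family.
  · rw [Finset.prod_eq_zero (Finset.mem_univ ⟨_, hk⟩) (by simp), Finset.card_eq_zero,
      Finset.filter_eq_empty_iff]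
    rintro v - ⟨hv, hU⟩
    have h : LinearIndependent F (fun i => (⟨v i, hU i⟩ : U)) :=
      LinearIndependent.of_comp U.subtype hv
    have := h.fintype_card_le_finrank
    simp at this
    omega

open scoped Classical in
/-- The number of rank `t` matrices whose column space contains a given linearly independent
family. -/
theorem card_filter_mem_range_mul {k t : ℕ} {v : Fin k → ι → F} (hv : LinearIndependent F v) :
    ((rankSet F ι κ t).filter fun E => ∀ i, v i ∈ LinearMap.range E.mulVecLin).card *
        ∏ i : Fin k, (Fintype.card F ^ Fintype.card ι - Fintype.card F ^ i.val) =
      (rankSet F ι κ t).card *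
        ∏ i : Fin k, (Fintype.card F ^ t - Fintype.card F ^ i.val) := by
  have htop := card_linearIndependent_in_submodule (⊤ : Submodule F (ι → F)) k
  simp only [Submodule.mem_top, implies_true, and_true, finrank_top,
    Module.finrank_fintype_fun_eq_card] at htop
  rw [← htop, mul_comm, ← smul_eq_mul, ← smul_eq_mul, ← Finset.sum_const, ← Finset.sum_const]
  -- Double counting of the pairs `(w, E)` with `w` independent in the column space of `E`: the
  -- count for fixed `w` is constant, and the count for fixed `E` depends only on the dimension `t`
  -- of that space.
  calc _ = ∑ w : Fin k → ι → F with LinearIndependent F w,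
        ((rankSet F ι κ t).filter fun E => ∀ i, w i ∈ LinearMap.range E.mulVecLin).card :=
        Finset.sum_congr rfl fun w hw =>
          card_filter_mem_range_eq hv (Finset.mem_filter.1 hw).2
    _ = ∑ E ∈ rankSet F ι κ t, (Finset.univ.filter fun w : Fin k → ι → F =>
          LinearIndependent F w ∧ ∀ i, w i ∈ LinearMap.range E.mulVecLin).card := by
        simp_rw [Finset.card_filter]
        rw [Finset.sum_comm, Finset.sum_congr rfl]
        intro E _
        rw [Finset.sum_filter]
        refine Finset.sum_congr rfl fun w _ => ?_
        by_cases h : LinearIndependent F w <;> simp [h]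
    _ = _ := by
        refine Finset.sum_congr rfl fun E hE => ?_
        rw [card_linearIndependent_in_submodule, ← mem_rankSet.1 hE]
        rfl

end Count

/-! ### Column spaces that meet the kernel of a folding -/

section Bad

variable {F : Type*} [Field F] [Fintype F]

open scoped Classical in
/-- Union bound: if the column space of every matrix in `B` contains at least `N` of the linearly
independent families `v z`, `z ∈ Z`, then `B` is small. -/
theorem card_mul_le_of_families {ι κ : Type*} [Fintype ι] [Fintype κ] {k t N : ℕ}
    (Z : Finset (ι → F)) (v : (ι → F) → Fin k → ι → F)
    (hv : ∀ z ∈ Z, LinearIndependent F (v z)) (B : Finset (Matrix ι κ F))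
    (hB : B ⊆ rankSet F ι κ t)
    (hN : ∀ E ∈ B, N ≤ (Z.filter fun z => ∀ i, v z i ∈ LinearMap.range E.mulVecLin).card) :
    N * B.card * ∏ i : Fin k, (Fintype.card F ^ Fintype.card ι - Fintype.card F ^ i.val) ≤
      Z.card * ((rankSet F ι κ t).card *
        ∏ i : Fin k, (Fintype.card F ^ t - Fintype.card F ^ i.val)) := by
  calc _ ≤ (∑ z ∈ Z, ((rankSet F ι κ t).filter fun E =>
          ∀ i, v z i ∈ LinearMap.range E.mulVecLin).card) *
        ∏ i : Fin k, (Fintype.card F ^ Fintype.card ι - Fintype.card F ^ i.val) := by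
        gcongr
        -- Pairs `(z, E)` are counted twice; the multiplicity `N` sharpens the plain union bound.
        calc N * B.card = ∑ E ∈ B, N := by rw [Finset.sum_const, smul_eq_mul, mul_comm]
          _ ≤ ∑ E ∈ B, (Z.filter fun z => ∀ i, v z i ∈ LinearMap.range E.mulVecLin).card :=
            Finset.sum_le_sum hN
          _ ≤ ∑ E ∈ rankSet F ι κ t,
              (Z.filter fun z => ∀ i, v z i ∈ LinearMap.range E.mulVecLin).card :=
            Finset.sum_le_sum_of_subset hB
          _ = _ := by
            simp_rw [Finset.card_filter]
            rw [Finset.sum_comm]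
    _ = ∑ z ∈ Z, (rankSet F ι κ t).card *
          ∏ i : Fin k, (Fintype.card F ^ t - Fintype.card F ^ i.val) := by
        rw [Finset.sum_mul]
        exact Finset.sum_congr rfl fun z hz => card_filter_mem_range_mul (hv z hz)
    _ = _ := by rw [Finset.sum_const, smul_eq_mul]

variable {m t : ℕ} {κ : Type*} [Fintype κ]

open scoped Classical in
/-- The matrices of rank `t` whose column space contains a nonzero vector `(x, c x)`. -/
noncomputable def badSet (m t : ℕ) (κ : Type*) [Fintype κ] (c : F) :
    Finset (Matrix (Fin m ⊕ Fin m) κ F) :=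
  (rankSet F (Fin m ⊕ Fin m) κ t).filter fun E => ∃ x : κ → F, E.mulVec x ≠ 0 ∧
    ∀ i, E.mulVec x (.inr i) = c * E.mulVec x (.inl i)

open scoped Classical in
/-- The matrices of rank `t` whose column space contains `(x, x')` and `(α x', β x)` for some
`(x, x') ≠ 0`. -/
noncomputable def badSetQ (m t : ℕ) (κ : Type*) [Fintype κ] (α β : F) :
    Finset (Matrix (Fin m ⊕ Fin m) κ F) :=
  (rankSet F (Fin m ⊕ Fin m) κ t).filter fun E => ∃ x y : κ → F, E.mulVec x ≠ 0 ∧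
    (∀ i, E.mulVec y (.inl i) = α * E.mulVec x (.inr i)) ∧
    ∀ i, E.mulVec y (.inr i) = β * E.mulVec x (.inl i)

theorem mem_badSet {c : F} {E : Matrix (Fin m ⊕ Fin m) κ F} : E ∈ badSet m t κ c ↔ E.rank = t ∧
    ∃ x : κ → F, E.mulVec x ≠ 0 ∧ ∀ i, E.mulVec x (.inr i) = c * E.mulVec x (.inl i) := by
  simp [badSet]

theorem mem_badSetQ {α β : F} {E : Matrix (Fin m ⊕ Fin m) κ F} :
    E ∈ badSetQ m t κ α β ↔ E.rank = t ∧ ∃ x y : κ → F, E.mulVec x ≠ 0 ∧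
      (∀ i, E.mulVec y (.inl i) = α * E.mulVec x (.inr i)) ∧
      ∀ i, E.mulVec y (.inr i) = β * E.mulVec x (.inl i) := by
  simp [badSetQ]

/-- Union bound over the at most `q^m - 1` nonzero vectors `(x, c x)`. Each lies in the column space
with probability `(q^t - 1)/(q^(2m) - 1)`, and a bad matrix contains at least `q - 1` of them, so
the bad proportion is at most `(q^t - 1)/((q - 1)(q^m + 1))`. -/
theorem card_badSet_le (hm : 0 < m) (c : F) :
    Fintype.card F * Fintype.card F ^ m * (badSet m t κ c).card ≤
      2 * (rankSet F (Fin m ⊕ Fin m) κ t).card * Fintype.card F ^ t := by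
  classical
  set q := Fintype.card F with hq
  have hq2 : 2 ≤ q := Fintype.one_lt_card
  set Z : Finset (Fin m ⊕ Fin m → F) :=
    Finset.univ.filter fun z => z ≠ 0 ∧ ∀ i, z (.inr i) = c * z (.inl i) with hZ
  have hZc : Z.card ≤ q ^ m - 1 := by
    calc Z.card ≤ (Finset.univ.erase (0 : Fin m → F)).card := by
          -- A vector of `Z` is determined by its upper half, which is nonzero.
          refine Finset.card_le_card_of_injOn (fun z i => z (.inl i)) ?_ ?_
          · intro z hz
            simp only [hZ, Finset.coe_filter, Finset.mem_univ, true_and, Set.mem_ofPred_eq] at hz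
            simp only [Finset.coe_erase, Finset.coe_univ, Set.mem_sdiff, Set.mem_univ,
              Set.mem_singleton_iff, true_and]
            intro h
            have h' (i : Fin m) : z (.inl i) = 0 := congrFun h i
            apply hz.1
            ext (i | i)
            · exact h' i
            · simp [hz.2 i, h' i]
          · intro z hz w hw h
            simp only [hZ, Finset.coe_filter, Finset.mem_univ, true_and, Set.mem_ofPred_eq] at hz hw
            have h' (i : Fin m) : z (.inl i) = w (.inl i) := congrFun h i
            ext (i | i)
            · exact h' i
            · rw [hz.2, hw.2, h']
      _ = q ^ m - 1 := by simp [hq]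
  have key := card_mul_le_of_families (t := t) (N := q - 1) Z (fun z (_ : Fin 1) => z)
    (fun z hz => by
      simpa [linearIndependent_unique_iff] using (Finset.mem_filter.1 hz).2.1)
    (badSet m t κ c) (Finset.filter_subset _ _) (by
      intro E hE
      obtain ⟨x, hx, hx'⟩ := (mem_badSet.1 hE).2
      calc q - 1 = (Finset.univ.erase (0 : F)).card := by simp [hq]
        _ ≤ _ := by
          refine Finset.card_le_card_of_injOn (fun d => d • E.mulVec x) ?_ ?_
          · intro d hd
            have hd : d ≠ 0 := by simpa using hd
            simp only [hZ, Finset.coe_filter, Finset.mem_filter, Finset.mem_univ, true_and,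
              Set.mem_ofPred_eq]
            refine ⟨⟨smul_ne_zero hd hx, fun i => ?_⟩, fun _ => ⟨d • x, ?_⟩⟩
            · simp only [Pi.smul_apply, smul_eq_mul, hx']
              ring
            · simp
          · intro d _ d' _ h
            exact smul_left_injective F hx h)
  simp only [Finset.univ_unique, Fin.val_eq_zero, pow_zero, Finset.prod_const,
    Finset.card_singleton, pow_one, Fintype.card_sum, Fintype.card_fin, ← hq] at key
  set S := (rankSet F (Fin m ⊕ Fin m) κ t).card
  set B := (badSet m t κ c).card
  have hQ : 2 ≤ q ^ m := hq2.trans (Nat.le_self_pow hm.ne' q)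
  -- The factor `q^m - 1` cancels against the bound for the size of `Z`.
  have hfac : q ^ (m + m) - 1 = (q ^ m - 1) * (q ^ m + 1) := by
    rw [pow_add, mul_comm (q ^ m - 1), ← Nat.mul_self_sub_mul_self_eq, one_mul]
  have h1 : (q ^ m - 1) * ((q - 1) * B * (q ^ m + 1)) ≤ (q ^ m - 1) * (S * q ^ t) := by
    calc _ = (q - 1) * B * (q ^ (m + m) - 1) := by rw [hfac]; ring
      _ ≤ Z.card * (S * (q ^ t - 1)) := key
      _ ≤ _ := by gcongr; omega
  have h2 := Nat.le_of_mul_le_mul_left h1 (by omega)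
  -- The constant `2` comes from `q ≤ 2 (q - 1)`.
  calc q * q ^ m * B ≤ (2 * (q - 1)) * (q ^ m + 1) * B := by gcongr <;> omega
    _ = 2 * ((q - 1) * B * (q ^ m + 1)) := by ring
    _ ≤ 2 * (S * q ^ t) := by gcongr
    _ = _ := by ring

/-- The relevant vectors are pairs `z, J z` with `J (x, x') = (α x', β x)` and `J² = α β`. As `α β`
is not a square, `J` has no eigenvector, so each pair is independent and the count with `k = 2`
applies. A bad column space contains a `J`-stable plane, hence at least `q² - 1` such `z`. -/
theorem card_badSetQ_le (hm : 0 < m) {α β : F} (hαβ : ¬ IsSquare (α * β)) :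
    Fintype.card F ^ 2 * Fintype.card F ^ (2 * m) * (badSetQ m t κ α β).card ≤
      4 * (rankSet F (Fin m ⊕ Fin m) κ t).card * Fintype.card F ^ (2 * t) := by
  classical
  set q := Fintype.card F with hq
  have hq2 : 2 ≤ q := Fintype.one_lt_card
  let J : (Fin m ⊕ Fin m → F) →ₗ[F] (Fin m ⊕ Fin m → F) :=
    { toFun := fun z => Sum.elim (fun i => α * z (.inr i)) (fun i => β * z (.inl i))
      map_add' := fun z w => by ext (i | i) <;> simp [mul_add]
      map_smul' := fun d z => by ext (i | i) <;> simp [mul_left_comm] }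
  have hJJ (z) : J (J z) = (α * β) • z := by
    ext (i | i) <;> simp [J] <;> ring
  have hJ {z} (hz : z ≠ 0) : LinearIndependent F ![z, J z] := by
    rw [LinearIndependent.pair_iff' hz]
    intro d hd
    apply hαβ
    refine ⟨d, ?_⟩
    -- An eigenvalue `d` of `J` would satisfy `d² = α β`.
    have : (α * β) • z = (d * d) • z := by rw [← hJJ, ← hd, map_smul, ← hd, smul_smul]
    exact smul_left_injective F hz this
  set Z : Finset (Fin m ⊕ Fin m → F) := Finset.univ.erase 0 with hZ
  have hZc : Z.card = q ^ (m + m) - 1 := by simp [hZ, hq]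
  have key := card_mul_le_of_families (t := t) (N := q ^ 2 - 1) Z (fun z => ![z, J z])
    (fun z hz => hJ (Finset.ne_of_mem_erase hz))
    (badSetQ m t κ α β) (Finset.filter_subset _ _) (by
      intro E hE
      obtain ⟨x, y, hx, hy, hy'⟩ := (mem_badSetQ.1 hE).2
      have hxy : E.mulVec y = J (E.mulVec x) := by
        ext (i | i)
        · exact hy i
        · exact hy' i
      have hli := LinearIndependent.pair_iff.1 (hJ hx)
      calc q ^ 2 - 1 = (Finset.univ.erase (0 : F × F)).card := by
            simp [hq, sq]
        _ ≤ _ := by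
          refine Finset.card_le_card_of_injOn
            (fun d => d.1 • E.mulVec x + d.2 • J (E.mulVec x)) ?_ ?_
          · intro d hd
            have hd : d ≠ 0 := by simpa using hd
            simp only [hZ, Finset.coe_filter, Finset.mem_erase, Finset.mem_univ, and_true,
              Set.mem_ofPred_eq, Fin.forall_fin_two, Matrix.cons_val_zero, Matrix.cons_val_one]
            -- Preimages of `z = d₁ E x + d₂ J(E x)` and of `J z`, since `E y = J (E x)` and `J² = α
            -- β`.
            refine ⟨fun h => hd ?_, ⟨d.1 • x + d.2 • y, ?_⟩, ⟨d.1 • y + (d.2 * (α * β)) • x, ?_⟩⟩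
            · have := hli _ _ h
              exact Prod.ext this.1 this.2
            · simp [Matrix.mulVec_add, Matrix.mulVec_smul, hxy]
            · simp [Matrix.mulVec_add, Matrix.mulVec_smul, hxy, hJJ, smul_smul]
          · intro d _ d' _ h
            have h0 : (d.1 - d'.1) • E.mulVec x + (d.2 - d'.2) • J (E.mulVec x) = 0 := by
              simp only at h
              rw [sub_smul, sub_smul, sub_add_sub_comm, h, sub_self]
            have := hli _ _ h0
            exact Prod.ext (sub_eq_zero.1 this.1) (sub_eq_zero.1 this.2))
  simp only [Fin.prod_univ_two, Fin.val_zero, Fin.val_one, pow_zero, pow_one, Fintype.card_sum,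
    Fintype.card_fin, ← hq, hZc] at key
  set S := (rankSet F (Fin m ⊕ Fin m) κ t).card
  set B := (badSetQ m t κ α β).card
  rw [← two_mul] at key
  have hq' : 2 * q ≤ q ^ 2 := by rw [sq]; gcongr
  have hQ : 2 * q ≤ q ^ (2 * m) := hq'.trans (Nat.pow_le_pow_right (by omega) (by omega))
  have h1 : (q ^ (2 * m) - 1) * ((q ^ 2 - 1) * B * (q ^ (2 * m) - q)) ≤
      (q ^ (2 * m) - 1) * (S * q ^ (2 * t)) := by
    calc _ = (q ^ 2 - 1) * B * ((q ^ (2 * m) - 1) * (q ^ (2 * m) - q)) := by ring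
      _ ≤ (q ^ (2 * m) - 1) * (S * ((q ^ t - 1) * (q ^ t - q))) := key
      _ ≤ (q ^ (2 * m) - 1) * (S * (q ^ t * q ^ t)) := by gcongr <;> omega
      _ = _ := by rw [two_mul t, pow_add]
  have h2 := Nat.le_of_mul_le_mul_left h1 (by omega)
  -- The constant `4` comes from `q² ≤ 2 (q² - 1)` and `q^(2m) ≤ 2 (q^(2m) - q)`; the latter uses `m
  -- > 0`.
  calc q ^ 2 * q ^ (2 * m) * B ≤ (2 * (q ^ 2 - 1)) * (2 * (q ^ (2 * m) - q)) * B := by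
        gcongr <;> omega
    _ = 4 * ((q ^ 2 - 1) * B * (q ^ (2 * m) - q)) := by ring
    _ ≤ 4 * (S * q ^ (2 * t)) := by gcongr
    _ = _ := by ring

end Bad

/-! ### Foldings of matrices -/

section Fold

variable {L : Type*} {m n : ℕ}

section CommRing

variable [CommRing L]

/-- The matrix `(ρ I  I)`. -/
def foldL (m : ℕ) (ρ : L) : Matrix (Fin m) (Fin m ⊕ Fin m) L := Matrix.fromCols (ρ • 1) 1

/-- The matrix `(I ; -ρ I)`. -/
def foldR (n : ℕ) (ρ : L) : Matrix (Fin n ⊕ Fin n) (Fin n) L := Matrix.fromRows 1 (-(ρ • 1))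

/-- The matrix `(0  I)`. -/
def bottomL (m : ℕ) (L : Type*) [CommRing L] : Matrix (Fin m) (Fin m ⊕ Fin m) L :=
  Matrix.fromCols 0 1

/-- The matrix `(I ; 0)`. -/
def leftR (n : ℕ) (L : Type*) [CommRing L] : Matrix (Fin n ⊕ Fin n) (Fin n) L :=
  Matrix.fromRows 1 0

/-- The folding `(ρ I  I) Y (I ; -ρ I)`. -/
def foldMat (ρ : L) (Y : BlockMat m n L) : Matrix (Fin m) (Fin n) L :=
  foldL m ρ * Y * foldR n ρ

/-- The bottom half of `Y (I ; -ρ I)`, or the left half of `(ρ I  I) Y`. -/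
def partMat (ρ : L) (Y : BlockMat m n L) : Side → Matrix (Fin m) (Fin n) L
  | .row => bottomL m L * (Y * foldR n ρ)
  | .col => (foldL m ρ * Y) * leftR n L

theorem foldMat_apply (ρ : L) (Y : BlockMat m n L) (i : Fin m) (j : Fin n) :
    foldMat ρ Y i j = ρ * Y (.inl i) (.inl j) + Y (.inr i) (.inl j)
      - ρ * ρ * Y (.inl i) (.inr j) - ρ * Y (.inr i) (.inr j) := by
  simp [foldMat, foldL, foldR, Matrix.mul_apply, Fintype.sum_sum_type, Matrix.one_apply,
    Matrix.smul_apply]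
  ring

theorem partMat_row_apply (ρ : L) (Y : BlockMat m n L) (i : Fin m) (j : Fin n) :
    partMat ρ Y .row i j = Y (.inr i) (.inl j) - ρ * Y (.inr i) (.inr j) := by
  simp only [partMat, foldR, bottomL, Matrix.mul_apply, Fintype.sum_sum_type]
  simp [Matrix.one_apply]
  ring

theorem partMat_col_apply (ρ : L) (Y : BlockMat m n L) (i : Fin m) (j : Fin n) :
    partMat ρ Y .col i j = Y (.inr i) (.inl j) + ρ * Y (.inl i) (.inl j) := by
  simp only [partMat, foldL, leftR, Matrix.mul_apply, Fintype.sum_sum_type]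
  simp [Matrix.one_apply]
  ring

theorem foldMat_add (ρ : L) (Y Z : BlockMat m n L) :
    foldMat ρ (Y + Z) = foldMat ρ Y + foldMat ρ Z := by
  simp [foldMat, Matrix.mul_add, Matrix.add_mul]

theorem partMat_add (ρ : L) (Y Z : BlockMat m n L) (side : Side) :
    partMat ρ (Y + Z) side = partMat ρ Y side + partMat ρ Z side := by
  cases side <;> simp only [partMat, Matrix.mul_add, Matrix.add_mul]

/-- A codeword of the Plotkin construction folds to a combination of `B₀` and `B₁`. -/
theorem foldMat_codeword {ρ b : L} (h : ρ * ρ * b = 1) (A₀ A₁ B₀ B₁ : Matrix (Fin m) (Fin n) L) :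
    foldMat ρ (Matrix.fromBlocks (A₀ + B₀) (b • (A₁ - B₁)) (A₁ + B₁) (A₀ - B₀)) =
      (2 * ρ) • B₀ + (2 : L) • B₁ := by
  ext i j
  simp only [foldMat_apply, Matrix.fromBlocks_apply₁₁, Matrix.fromBlocks_apply₁₂,
    Matrix.fromBlocks_apply₂₁, Matrix.fromBlocks_apply₂₂, Matrix.add_apply, Matrix.sub_apply,
    Matrix.smul_apply, smul_eq_mul]
  linear_combination (-(A₁ i j - B₁ i j)) * h

/-- This keeps the folded error within the radius of the error decoder, whatever `E` is. -/
theorem rank_foldMat_le [Nontrivial L] (ρ : L) (E : BlockMat m n L) :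
    (foldMat ρ E).rank ≤ E.rank :=
  (Matrix.rank_mul_le_left _ _).trans (Matrix.rank_mul_le_right _ _)

end CommRing

variable [Field L]

/-- If folding preserves the rank of `E`, then the row (column) space of the folding of `E` contains
that of the partial folding. -/
theorem spaceLE_partMat_foldMat (side : Side) (ρ : L) (E : BlockMat m n L)
    (h : (foldMat ρ E).rank = E.rank) : SpaceLE side (partMat ρ E side) (foldMat ρ E) := by
  cases side
  · rw [foldMat, Matrix.mul_assoc] at h ⊢
    exact span_range_row_le_of_rank_le _ _ _ ((Matrix.rank_mul_le_left _ _).trans h.ge)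
  · exact span_range_col_le_of_rank_le _ _ _ ((Matrix.rank_mul_le_right _ _).trans h.ge)

/-- Folding preserves the rank unless the column space or the row space of `E` meets the
relevant kernel. -/
theorem rank_foldMat_eq {ρ : L} (hρ : ρ ≠ 0) (E : BlockMat m n L)
    (hc : ∀ v, (∀ i, E.mulVec v (.inr i) = -ρ * E.mulVec v (.inl i)) → E.mulVec v = 0)
    (hr : ∀ v, (∀ i, E.transpose.mulVec v (.inr i) = ρ⁻¹ * E.transpose.mulVec v (.inl i)) →
      E.transpose.mulVec v = 0) : (foldMat ρ E).rank = E.rank := by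
  refine rank_mul_mul_eq_of_injOn _ _ _ (fun v hv => hc v fun i => ?_)
    (fun v hv => hr v fun i => ?_)
  · have := congrFun hv i
    simp [foldL, Matrix.mulVec, dotProduct, Fintype.sum_sum_type, Matrix.one_apply] at this ⊢
    linear_combination this
  · have := congrFun hv i
    simp [foldR, Matrix.mulVec, dotProduct, Fintype.sum_sum_type, Matrix.one_apply] at this ⊢
    field_simp
    linear_combination -this

theorem rank_foldMat_eq_of_notMem_badSet {F : Type*} [Field F] [Fintype F] {t : ℕ} {ρ : F}
    (hρ : ρ ≠ 0) {E : BlockMat m n F} (hE : E.rank = t)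
    (hc : E ∉ badSet m t (Fin n ⊕ Fin n) (-ρ))
    (hr : E.transpose ∉ badSet n t (Fin m ⊕ Fin m) ρ⁻¹) : (foldMat ρ E).rank = t := by
  rw [← hE]
  refine rank_foldMat_eq hρ E (fun v hv => ?_) (fun v hv => ?_)
  · by_contra h
    exact hc (mem_badSet.2 ⟨hE, v, h, hv⟩)
  · by_contra h
    exact hr (mem_badSet.2
      ⟨(Matrix.rank_transpose E).trans hE, v, h, hv⟩)

end Fold

/-! ### The quadratic extension -/

section Quad

variable {F : Type u} [Field F] {a : F}

/-- The form of irreducibility of `x² - a` from which the field structure on `QuadExt a` is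
inferred. -/
theorem quadExt_fact (ha : ¬ IsSquare a) : Fact (∀ r : F, r ^ 2 ≠ a + 0 * r) :=
  ⟨fun r hr => ha ⟨r, by rw [← sq, hr]; ring⟩⟩

/-- A matrix over `F`, seen as a matrix over `F(√a)`. -/
def toQuad {ι κ : Type*} (a : F) (M : Matrix ι κ F) : Matrix ι κ (QuadExt a) :=
  M.map (algebraMap F (QuadExt a))

theorem toQuad_apply {ι κ : Type*} (M : Matrix ι κ F) (i : ι) (j : κ) :
    toQuad a M i j = ⟨M i j, 0⟩ := rfl

variable {ι κ : Type*} [Fintype κ]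

theorem re_toQuad_mulVec (E : Matrix ι κ F) (v : κ → QuadExt a) (i : ι) :
    ((toQuad a E).mulVec v i).re = E.mulVec (fun j => (v j).re) i := by
  simp only [Matrix.mulVec, dotProduct]
  rw [← QuadraticAlgebra.reₗ_apply, map_sum]
  simp [toQuad_apply]

theorem im_toQuad_mulVec (E : Matrix ι κ F) (v : κ → QuadExt a) (i : ι) :
    ((toQuad a E).mulVec v i).im = E.mulVec (fun j => (v j).im) i := by
  simp only [Matrix.mulVec, dotProduct]
  rw [← QuadraticAlgebra.imₗ_apply, map_sum]
  simp [toQuad_apply]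

/-- The rank of a matrix over a finite field does not change over the quadratic extension. -/
theorem rank_toQuad [Fintype F] (ha : ¬ IsSquare a) [Fintype ι] (E : Matrix ι κ F) :
    (toQuad a E).rank = E.rank := by
  have := quadExt_fact ha
  have : Finite (QuadExt a) := Finite.of_equiv _ (QuadraticAlgebra.equivProd a 0).symm
  have hcard : Nat.card (QuadExt a) = Nat.card F ^ 2 := by
    rw [Nat.card_congr (QuadraticAlgebra.equivProd a 0), Nat.card_prod, sq]
  -- Taking coordinates identifies the column space over `F(√a)` with two copies of the one over
  -- `F`. Comparing cardinalities, `(q²)^(rank over F(√a)) = q^(2 · rank over F)`.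
  let e : LinearMap.range (toQuad a E).mulVecLin ≃
      LinearMap.range E.mulVecLin × LinearMap.range E.mulVecLin :=
    { toFun := fun w => (⟨fun i => (w.1 i).re, by
          obtain ⟨_, v, rfl⟩ := w
          exact ⟨fun j => (v j).re, funext fun i => (re_toQuad_mulVec E v i).symm⟩⟩,
        ⟨fun i => (w.1 i).im, by
          obtain ⟨_, v, rfl⟩ := w
          exact ⟨fun j => (v j).im, funext fun i => (im_toQuad_mulVec E v i).symm⟩⟩)
      invFun := fun p => ⟨fun i => ⟨p.1.1 i, p.2.1 i⟩, by
          obtain ⟨⟨_, v, rfl⟩, ⟨_, v', rfl⟩⟩ := p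
          refine ⟨fun j => ⟨v j, v' j⟩, funext fun i => ?_⟩
          exact QuadraticAlgebra.ext (re_toQuad_mulVec E _ i) (im_toQuad_mulVec E _ i)⟩
      left_inv := fun w => rfl
      right_inv := fun p => rfl }
  have h := Nat.card_congr e
  rw [Nat.card_prod, Module.natCard_eq_pow_finrank (K := F) (V := LinearMap.range E.mulVecLin),
    Module.natCard_eq_pow_finrank (K := QuadExt a) (V := LinearMap.range (toQuad a E).mulVecLin),
    hcard, ← pow_mul, ← pow_add] at h
  have := Nat.pow_right_injective Finite.one_lt_card h
  unfold Matrix.rank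
  omega

/-- Splitting a kernel vector `x + y √a` into coordinates turns the condition over `F(√a)` into two
conditions over `F` that express `y` through `x`. In particular `x = 0` forces `y = 0`, so a nonzero
kernel vector has `x ≠ 0`. -/
theorem rank_foldMat_toQuad_eq_of_notMem_badSetQ [Fintype F] {m n t : ℕ} (ha : ¬ IsSquare a)
    {E : BlockMat m n F} (hE : E.rank = t)
    (hc : E ∉ badSetQ m t (Fin n ⊕ Fin n) (-1) (-a⁻¹))
    (hr : E.transpose ∉ badSetQ n t (Fin m ⊕ Fin m) a⁻¹ 1) :
    (foldMat (⟨0, a⁻¹⟩ : QuadExt a) (toQuad a E)).rank = t := by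
  have := quadExt_fact ha
  have ha0 : a ≠ 0 := by rintro rfl; exact ha ⟨0, by simp⟩
  have hinv : (⟨0, a⁻¹⟩ : QuadExt a)⁻¹ = ⟨0, 1⟩ := by
    apply inv_eq_of_mul_eq_one_right
    ext <;> simp [ha0, QuadraticAlgebra.re_one, QuadraticAlgebra.im_one]
  rw [← hE, ← rank_toQuad ha E]
  refine rank_foldMat_eq ?_ _ (fun v hv => ?_) (fun v hv => ?_)
  · intro h
    simpa [ha0] using congrArg QuadraticAlgebra.im h
  · have h1 (i) : E.mulVec (fun j => (v j).im) (.inl i) =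
        -1 * E.mulVec (fun j => (v j).re) (.inr i) := by
      have := congrArg QuadraticAlgebra.re (hv i)
      simp [re_toQuad_mulVec, im_toQuad_mulVec, ha0] at this
      rw [this]; ring
    have h2 (i) : E.mulVec (fun j => (v j).im) (.inr i) =
        -a⁻¹ * E.mulVec (fun j => (v j).re) (.inl i) := by
      have := congrArg QuadraticAlgebra.im (hv i)
      simpa [re_toQuad_mulVec, im_toQuad_mulVec, ha0] using this
    have h0 : E.mulVec (fun j => (v j).re) = 0 := by
      by_contra h
      exact hc (mem_badSetQ.2 ⟨hE, _, _, h, h1, h2⟩)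
    ext i
    · simp [re_toQuad_mulVec, h0]
    · rcases i with i | i <;> simp [im_toQuad_mulVec, h1, h2, h0]
  · rw [hinv] at hv
    change ∀ i, (toQuad a E.transpose).mulVec v (.inr i) =
      _ * (toQuad a E.transpose).mulVec v (.inl i) at hv
    change (toQuad a E.transpose).mulVec v = 0
    have h1 (i) : E.transpose.mulVec (fun j => (v j).im) (.inl i) =
        a⁻¹ * E.transpose.mulVec (fun j => (v j).re) (.inr i) := by
      have := congrArg QuadraticAlgebra.re (hv i)
      simp [re_toQuad_mulVec, im_toQuad_mulVec] at this
      rw [this]; field_simp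
    have h2 (i) : E.transpose.mulVec (fun j => (v j).im) (.inr i) =
        1 * E.transpose.mulVec (fun j => (v j).re) (.inl i) := by
      have := congrArg QuadraticAlgebra.im (hv i)
      simpa [re_toQuad_mulVec, im_toQuad_mulVec] using this
    have h0 : E.transpose.mulVec (fun j => (v j).re) = 0 := by
      by_contra h
      exact hr (mem_badSetQ.2
        ⟨(Matrix.rank_transpose E).trans hE, _, _, h, h1, h2⟩)
    ext i
    · simp [re_toQuad_mulVec, h0]
    · rcases i with i | i <;> simp [im_toQuad_mulVec, h1, h2, h0]

end Quad

/-! ### Evaluation and cost of algorithms -/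

namespace Expr

variable {F : Type u} {V : Type}

@[simp] theorem eval_var [Field F] (v : V) (ρ : V → F) : (var v : Expr F V).eval ρ = ρ v := rfl
@[simp] theorem eval_const [Field F] (c : F) (ρ : V → F) : (const c : Expr F V).eval ρ = c := rfl
@[simp] theorem eval_add [Field F] (e e' : Expr F V) (ρ : V → F) :
    (e + e').eval ρ = e.eval ρ + e'.eval ρ := rfl
@[simp] theorem eval_sub [Field F] (e e' : Expr F V) (ρ : V → F) :
    (e - e').eval ρ = e.eval ρ - e'.eval ρ := rfl
@[simp] theorem eval_mul [Field F] (e e' : Expr F V) (ρ : V → F) :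
    (e * e').eval ρ = e.eval ρ * e'.eval ρ := rfl

@[simp] theorem ops_var (v : V) : (var v : Expr F V).ops = 0 := rfl
@[simp] theorem ops_const (c : F) : (const c : Expr F V).ops = 0 := rfl
@[simp] theorem ops_add (e e' : Expr F V) : (e + e').ops = e.ops + e'.ops + 1 := rfl
@[simp] theorem ops_sub (e e' : Expr F V) : (e - e').ops = e.ops + e'.ops + 1 := rfl
@[simp] theorem ops_mul (e e' : Expr F V) : (e * e').ops = e.ops + e'.ops + 1 := rfl

end Expr

namespace Prog

variable {F : Type u} [Field F] [DecidableEq F] {V κ : Type}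

theorem eval_ret (out : κ → V) (ρ : V → F) :
    (ret out : Prog F V κ).eval ρ = some fun k => ρ (out k) := rfl

theorem eval_block {ι : Type} [Fintype ι] (e : ι → Expr F V) (k : Prog F (V ⊕ ι) κ) (ρ : V → F) :
    (block e k).eval ρ = k.eval (Sum.elim ρ fun i => (e i).eval ρ) := rfl

/-- The equation `hx` is kept as a hypothesis so that rewriting leaves the identification of the
subroutine's input as a separate goal. -/
theorem eval_call {I O : Type} {sub : Prog F I O} {inp : I → V} {k : Prog F (V ⊕ O) κ}
    {ρ : V → F} {x : I → F} {out : O → F} (h : sub.eval x = some out)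
    (hx : (fun i => ρ (inp i)) = x) :
    (call sub inp k).eval ρ = k.eval (Sum.elim ρ out) := by
  subst hx
  simp [eval, h]

theorem CostAtMost.ret (out : κ → V) : (ret out : Prog F V κ).CostAtMost 0 := fun _ => le_rfl

theorem CostAtMost.block {ι : Type} [Fintype ι] {e : ι → Expr F V} {k : Prog F (V ⊕ ι) κ}
    {c d : ℕ} (he : ∑ i, (e i).ops ≤ c) (hk : k.CostAtMost d) :
    (block e k).CostAtMost (c + d) := fun _ => add_le_add he (hk _)

theorem CostAtMost.call {I O : Type} {sub : Prog F I O} {inp : I → V} {k : Prog F (V ⊕ O) κ}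
    {c d : ℕ} (hs : sub.CostAtMost c) (hk : k.CostAtMost d) :
    (call sub inp k).CostAtMost (c + d) := by
  intro ρ
  refine add_le_add (hs _) ?_
  split
  · exact Nat.zero_le _
  · exact hk _

theorem CostAtMost.mono {p : Prog F V κ} {c d : ℕ} (hp : p.CostAtMost c) (h : c ≤ d) :
    p.CostAtMost d := fun ρ => (hp ρ).trans h

end Prog

section Encoding

variable {F : Type u}

theorem enc_unenc {ι κ : Type} (x : ι × κ → F) : enc (unenc x) = x := rfl

theorem encQ_unencQ [Zero F] {a : F} {ι κ : Type} (x : (ι × κ) × Fin 2 → F) :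
    encQ (unencQ x : Matrix ι κ (QuadExt a)) = x := by
  ext ⟨⟨i, j⟩, k⟩
  fin_cases k <;> rfl

variable [Field F] [DecidableEq F] {m n : ℕ}

theorem errorDec_eq_some {p : Prog F (Idx m n) (Idx m n)} {Y X : Matrix (Fin m) (Fin n) F}
    (h : errorDec p Y = some X) : p.eval (enc Y) = some (enc X) := by
  obtain ⟨x, hx, rfl⟩ := Option.map_eq_some_iff.1 h
  rw [hx, enc_unenc]

theorem erasureDec_eq_some {p : Prog F (Idx m n ⊕ Idx m n) (Idx m n)}
    {Y W X : Matrix (Fin m) (Fin n) F} (h : erasureDec p Y W = some X) :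
    p.eval (Sum.elim (enc Y) (enc W)) = some (enc X) := by
  obtain ⟨x, hx, rfl⟩ := Option.map_eq_some_iff.1 h
  rw [hx, enc_unenc]

theorem errorDecQ_eq_some {a : F} {p : Prog F (QIdx m n) (QIdx m n)}
    {Y X : Matrix (Fin m) (Fin n) (QuadExt a)} (h : errorDecQ p Y = some X) :
    p.eval (encQ Y) = some (encQ X) := by
  obtain ⟨x, hx, rfl⟩ := Option.map_eq_some_iff.1 h
  rw [hx, encQ_unencQ]

theorem erasureDecQ_eq_some {a : F} {p : Prog F (QIdx m n ⊕ QIdx m n) (QIdx m n)}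
    {Y W X : Matrix (Fin m) (Fin n) (QuadExt a)} (h : erasureDecQ p Y W = some X) :
    p.eval (Sum.elim (encQ Y) (encQ W)) = some (encQ X) := by
  obtain ⟨x, hx, rfl⟩ := Option.map_eq_some_iff.1 h
  rw [hx, encQ_unencQ]

theorem pairDec_eq_some {p : Prog F (BIdx m n) (BIdx m n ⊕ BIdx m n)} {Y X E : BlockMat m n F}
    (h : p.eval (enc Y) = some (Sum.elim (enc X) (enc E))) : pairDec p Y = some (X, E) := by
  rw [pairDec, h]
  rfl

end Encoding

/-! ### Cost of the decoding algorithms -/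

section Cost

variable {F : Type u} [Field F] [DecidableEq F] {m n : ℕ}

theorem decodeSquare_costAtMost (side : Side) (s : F) {decD : Prog F (Idx m n) (Idx m n)}
    {decC : Prog F (Idx m n ⊕ Idx m n) (Idx m n)} {c d : ℕ} (hC : decC.CostAtMost c)
    (hD : decD.CostAtMost d) :
    (decodeSquare side s decD decC).CostAtMost (64 * (m * n) + 2 * (c + d)) := by
  -- Per position: `6` operations for each folding, `8 + 1` for each partial folding and folded
  -- error, `21` for the codeword, `4` for the final difference. The sum `55` is rounded up to `64`.
  refine Prog.CostAtMost.mono (c := 12 * (m * n) + (d + (d + (18 * (m * n) + (c + (c +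
    (21 * (m * n) + (4 * (m * n) + 0)))))))) ?_ (by omega)
  refine .block ?_ (.call hD (.call hD (.block ?_ (.call hC (.call hC
    (.block ?_ (.block ?_ (.ret _))))))))
  · simp [fold, Fintype.sum_sum_type]
    linarith [Nat.zero_le (m * n)]
  · cases side <;> simp [partialFold, removeB, Fintype.sum_sum_type] <;>
      linarith [Nat.zero_le (m * n)]
  · simp [codeword, Fintype.sum_prod_type, Fintype.sum_sum_type, Finset.sum_add_distrib]
    linarith [Nat.zero_le (m * n)]
  · simp
    linarith [Nat.zero_le (m * n)]

theorem decodeNonsquare_costAtMost (side : Side) (a : F) {decD : Prog F (QIdx m n) (QIdx m n)}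
    {decC : Prog F (QIdx m n ⊕ QIdx m n) (QIdx m n)} {c d : ℕ} (hC : decC.CostAtMost c)
    (hD : decD.CostAtMost d) :
    (decodeNonsquare side a decD decC).CostAtMost (64 * (m * n) + (c + d)) := by
  -- The block bounds of the square case are reused; they are not sharp here.
  refine Prog.CostAtMost.mono (c := 12 * (m * n) + (d + (18 * (m * n) + (c +
    (21 * (m * n) + (4 * (m * n) + 0)))))) ?_ (by omega)
  refine .block ?_ (.call hD (.block ?_ (.call hC (.block ?_ (.block ?_ (.ret _))))))
  · simp [foldQ, Fintype.sum_prod_type]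
    linarith [Nat.zero_le (m * n)]
  · cases side <;> simp [partialFoldQ, removeB, Fintype.sum_prod_type, Fintype.sum_sum_type] <;>
      linarith [Nat.zero_le (m * n)]
  · simp [codeword, Fintype.sum_prod_type, Fintype.sum_sum_type, Finset.sum_add_distrib]
    linarith [Nat.zero_le (m * n)]
  · simp
    linarith [Nat.zero_le (m * n)]

end Cost

/-! ### Correctness of the decoding algorithms -/

section Correct

variable {F : Type u} [Field F] {m n : ℕ} {V : Type} {ρ : V → F}

theorem eval_fold {Ye : BIdx m n → Expr F V} {Y : BlockMat m n F}
    (hY : ∀ k, (Ye k).eval ρ = enc Y k) (r : F) (p : Idx m n) :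
    (fold r Ye p).eval ρ = enc (foldMat r⁻¹ Y) p := by
  simp [fold, hY, enc, foldMat_apply]

theorem eval_partialFold {Ye : BIdx m n → Expr F V} {Y : BlockMat m n F}
    (hY : ∀ k, (Ye k).eval ρ = enc Y k) (r : F) (side : Side) (p : Idx m n) :
    (partialFold r Ye side p).eval ρ = enc (partMat r⁻¹ Y side) p := by
  cases side <;> simp [partialFold, hY, enc, partMat_row_apply, partMat_col_apply]

theorem eval_foldQ {a : F} (ha : a ≠ 0) {Ye : BIdx m n → Expr F V} {Y : BlockMat m n F}
    (hY : ∀ k, (Ye k).eval ρ = enc Y k) (p : QIdx m n) :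
    (foldQ a Ye p).eval ρ = encQ (foldMat (⟨0, a⁻¹⟩ : QuadExt a) (toQuad a Y)) p := by
  obtain ⟨⟨i, j⟩, k⟩ := p
  fin_cases k
  · simp [foldQ, hY, enc, encQ, foldMat_apply, toQuad_apply, ha]
  · simp [foldQ, hY, enc, encQ, foldMat_apply, toQuad_apply]
    ring

theorem eval_partialFoldQ {a : F} {Ye : BIdx m n → Expr F V} {Y : BlockMat m n F}
    (hY : ∀ k, (Ye k).eval ρ = enc Y k) (side : Side) (p : QIdx m n) :
    (partialFoldQ a Ye side p).eval ρ =
      encQ (partMat (⟨0, a⁻¹⟩ : QuadExt a) (toQuad a Y) side) p := by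
  obtain ⟨⟨i, j⟩, k⟩ := p
  cases side <;> fin_cases k <;>
    simp [partialFoldQ, hY, enc, encQ, partMat_row_apply, partMat_col_apply, toQuad_apply]

theorem eval_codeword {A₀e A₁e B₀e B₁e : Idx m n → Expr F V}
    {A₀ A₁ B₀ B₁ : Matrix (Fin m) (Fin n) F}
    (hA₀ : ∀ p, (A₀e p).eval ρ = enc A₀ p) (hA₁ : ∀ p, (A₁e p).eval ρ = enc A₁ p)
    (hB₀ : ∀ p, (B₀e p).eval ρ = enc B₀ p) (hB₁ : ∀ p, (B₁e p).eval ρ = enc B₁ p)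
    (a : F) (k : BIdx m n) : (codeword a A₀e A₁e B₀e B₁e k).eval ρ =
      enc (Matrix.fromBlocks (A₀ + B₀) (a • (A₁ - B₁)) (A₁ + B₁) (A₀ - B₀)) k := by
  rcases k with ⟨i | i, j | j⟩ <;> simp [codeword, hA₀, hA₁, hB₀, hB₁, enc]

theorem eval_removeB {Ye : BIdx m n → Expr F V} {B₀e B₁e : Idx m n → Expr F V} {a : F}
    {A₀ A₁ B₀ B₁ : Matrix (Fin m) (Fin n) F} {E : BlockMat m n F}
    (hY : ∀ k, (Ye k).eval ρ =
      enc (Matrix.fromBlocks (A₀ + B₀) (a • (A₁ - B₁)) (A₁ + B₁) (A₀ - B₀) + E) k)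
    (hB₀ : ∀ p, (B₀e p).eval ρ = enc B₀ p) (hB₁ : ∀ p, (B₁e p).eval ρ = enc B₁ p)
    (k : BIdx m n) : (removeB a Ye B₀e B₁e k).eval ρ =
      enc (Matrix.fromBlocks A₀ (a • A₁) A₁ A₀ + E) k := by
  rcases k with ⟨i | i, j | j⟩ <;> simp [removeB, hY, hB₀, hB₁, enc] <;> ring

theorem toQuad_add {ι κ : Type*} (a : F) (M N : Matrix ι κ F) :
    toQuad a (M + N) = toQuad a M + toQuad a N := by
  ext i j <;> simp [toQuad_apply]

theorem toQuad_codeword {a : F} {A₀ A₁ B₀ B₁ : Matrix (Fin m) (Fin n) F} {X : BlockMat m n F}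
    (hX : X = Matrix.fromBlocks (A₀ + B₀) (a • (A₁ - B₁)) (A₁ + B₁) (A₀ - B₀)) :
    toQuad a X = Matrix.fromBlocks (toQuad a A₀ + toQuad a B₀)
      (algebraMap F (QuadExt a) a • (toQuad a A₁ - toQuad a B₁))
      (toQuad a A₁ + toQuad a B₁) (toQuad a A₀ - toQuad a B₀) := by
  subst hX
  have h : algebraMap F (QuadExt a) a = ⟨a, 0⟩ := rfl
  ext (i | i) (j | j) <;> simp [toQuad_apply, h]

variable [DecidableEq F]

/-- The purely algebraic half of correctness, with the decoders' answers assumed for both roots `r =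
±s`. Sums and differences of these answers are `4 B₁`, `4 s⁻¹ B₀` and `2 A₁`, `2 ε s⁻¹ A₀` with `ε²
= 1`. -/
theorem pairDec_decodeSquare (h2 : (2 : F) ≠ 0) {s : F} (hs : s ≠ 0) (side : Side)
    {decD : Prog F (Idx m n) (Idx m n)} {decC : Prog F (Idx m n ⊕ Idx m n) (Idx m n)}
    {A₀ A₁ B₀ B₁ : Matrix (Fin m) (Fin n) F} {X E : BlockMat m n F}
    (hX : X = Matrix.fromBlocks (A₀ + B₀) ((s * s) • (A₁ - B₁)) (A₁ + B₁) (A₀ - B₀))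
    (hD : ∀ r : F, r * r = s * s →
      errorDec decD (foldMat r⁻¹ (X + E)) = some ((2 * r⁻¹) • B₀ + (2 : F) • B₁))
    (hC : ∀ r : F, r * r = s * s → erasureDec decC
      (partMat r⁻¹ (Matrix.fromBlocks A₀ ((s * s) • A₁) A₁ A₀ + E) side) (foldMat r⁻¹ E) =
        some (A₁ + (sign F side * r⁻¹) • A₀)) :
    pairDec (decodeSquare side s decD decC) (X + E) = some (X, E) := by
  have h4 : (4 : F) ≠ 0 := by
    have : (4 : F) = 2 * 2 := by norm_num
    rw [this]
    exact mul_ne_zero h2 h2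
  have hss : -s * -s = s * s := by ring
  have hD1 := errorDec_eq_some (hD s rfl)
  have hD2 := errorDec_eq_some (hD (-s) hss)
  have hC1 := erasureDec_eq_some (hC s rfl)
  have hC2 := erasureDec_eq_some (hC (-s) hss)
  have hE (r : F) (hr : r * r = s * s) (p : Idx m n) : enc (foldMat r⁻¹ (X + E)) p -
      enc ((2 * r⁻¹) • B₀ + (2 : F) • B₁) p = enc (foldMat r⁻¹ E) p := by
    rw [foldMat_add, hX, foldMat_codeword]
    · simp [enc]
    · rw [← hr]
      have : r ≠ 0 := by rintro rfl; simp [hs] at hr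
      field_simp
  have hB₀ (p : Idx m n) : s / 4 * (enc ((2 * s⁻¹) • B₀ + (2 : F) • B₁) p -
      enc ((2 * (-s)⁻¹) • B₀ + (2 : F) • B₁) p) = enc B₀ p := by
    simp [enc]
    field_simp
    ring
  have hB₁ (p : Idx m n) : 1 / 4 * (enc ((2 * s⁻¹) • B₀ + (2 : F) • B₁) p +
      enc ((2 * (-s)⁻¹) • B₀ + (2 : F) • B₁) p) = enc B₁ p := by
    simp [enc]
    field_simp
    ring
  have hA₀ (p : Idx m n) : sign F side * s / 2 * (enc (A₁ + (sign F side * s⁻¹) • A₀) p -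
      enc (A₁ + (sign F side * (-s)⁻¹) • A₀) p) = enc A₀ p := by
    cases side <;> simp [enc, sign] <;> field_simp <;> ring
  have hA₁ (p : Idx m n) : 1 / 2 * (enc (A₁ + (sign F side * s⁻¹) • A₀) p +
      enc (A₁ + (sign F side * (-s)⁻¹) • A₀) p) = enc A₁ p := by
    cases side <;> simp [enc, sign] <;> field_simp <;> ring
  apply pairDec_eq_some
  rw [decodeSquare, Prog.eval_block, Prog.eval_call hD1, Prog.eval_call hD2, Prog.eval_block,
    Prog.eval_call hC1, Prog.eval_call hC2, Prog.eval_block, Prog.eval_block, Prog.eval_ret]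
  · congr 1
    funext k
    rcases k with k | k
    · refine (eval_codeword hA₀ hA₁ hB₀ hB₁ _ k).trans ?_
      rw [hX]; rfl
    · refine (congrArg (enc (X + E) k - ·)
        (eval_codeword hA₀ hA₁ hB₀ hB₁ _ k)).trans ?_
      rw [← hX]
      simp [enc]
  -- The remaining goals identify the inputs of the subroutine calls: first those of the erasure
  -- decoder, then those of the error decoder.
  · funext k
    rcases k with k | k
    · exact eval_partialFold (eval_removeB (fun k => by rw [← hX]; rfl) hB₀ hB₁) _ _ _
    · refine (congrArg (· - _) (eval_fold (fun k => rfl) _ _)).trans (hE (-s) hss k)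
  · funext k
    rcases k with k | k
    · exact eval_partialFold (eval_removeB (fun k => by rw [← hX]; rfl) hB₀ hB₁) _ _ _
    · refine (congrArg (· - _) (eval_fold (fun k => rfl) _ _)).trans (hE s rfl k)
  · funext k
    exact eval_fold (fun k => rfl) _ _
  · funext k
    exact eval_fold (fun k => rfl) _ _

/-- One root suffices: `r = a⁻¹ √a` is purely imaginary, so the coordinates of each decoder's answer
are multiples of `B₁` and `B₀`, or of `A₁` and `A₀`. -/
theorem pairDec_decodeNonsquare (h2 : (2 : F) ≠ 0) {a : F} (ha : a ≠ 0) (side : Side)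
    {decD : Prog F (QIdx m n) (QIdx m n)} {decC : Prog F (QIdx m n ⊕ QIdx m n) (QIdx m n)}
    {A₀ A₁ B₀ B₁ : Matrix (Fin m) (Fin n) F} {X E : BlockMat m n F} {r : QuadExt a}
    (hr : r = ⟨0, a⁻¹⟩)
    (hX : X = Matrix.fromBlocks (A₀ + B₀) (a • (A₁ - B₁)) (A₁ + B₁) (A₀ - B₀))
    (hD : errorDecQ decD (foldMat r (toQuad a (X + E))) =
      some ((2 * r) • toQuad a B₀ + (2 : QuadExt a) • toQuad a B₁))
    (hC : erasureDecQ decC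
      (partMat r (toQuad a (Matrix.fromBlocks A₀ (a • A₁) A₁ A₀ + E)) side)
      (foldMat r (toQuad a E)) =
        some (toQuad a A₁ + (algebraMap F (QuadExt a) (sign F side) * r) • toQuad a A₀)) :
    pairDec (decodeNonsquare side a decD decC) (X + E) = some (X, E) := by
  have hD1 := errorDecQ_eq_some hD
  have hC1 := erasureDecQ_eq_some hC
  have htwo : (2 : QuadExt a) = ⟨2, 0⟩ := by
    rw [← one_add_one_eq_two]
    exact QuadraticAlgebra.ext one_add_one_eq_two (add_zero 0)
  have hsign : algebraMap F (QuadExt a) (sign F side) = ⟨sign F side, 0⟩ := rfl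
  have hP0 (p : Idx m n) : encQ ((2 * r) • toQuad a B₀ + (2 : QuadExt a) • toQuad a B₁) (p, 0) =
      2 * enc B₁ p := by
    simp [encQ, enc, hr, htwo, toQuad_apply]
  have hP1 (p : Idx m n) : encQ ((2 * r) • toQuad a B₀ + (2 : QuadExt a) • toQuad a B₁) (p, 1) =
      2 * a⁻¹ * enc B₀ p := by
    simp [encQ, enc, hr, htwo, toQuad_apply]
  have hR0 (p : Idx m n) : encQ (toQuad a A₁ +
      (algebraMap F (QuadExt a) (sign F side) * r) • toQuad a A₀) (p, 0) = enc A₁ p := by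
    simp [encQ, enc, hr, hsign, toQuad_apply]
  have hR1 (p : Idx m n) : encQ (toQuad a A₁ +
      (algebraMap F (QuadExt a) (sign F side) * r) • toQuad a A₀) (p, 1) =
        sign F side * a⁻¹ * enc A₀ p := by
    simp [encQ, enc, hr, hsign, toQuad_apply]
  have hE (p : QIdx m n) : encQ (foldMat r (toQuad a (X + E))) p -
      encQ ((2 * r) • toQuad a B₀ + (2 : QuadExt a) • toQuad a B₁) p =
        encQ (foldMat r (toQuad a E)) p := by
    have h : foldMat r (toQuad a (X + E)) =
        (2 * r) • toQuad a B₀ + (2 : QuadExt a) • toQuad a B₁ + foldMat r (toQuad a E) := by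
      rw [toQuad_add, foldMat_add, toQuad_codeword hX, foldMat_codeword]
      rw [hr]
      ext <;> simp [ha, QuadraticAlgebra.re_one, QuadraticAlgebra.im_one,
        QuadraticAlgebra.algebraMap_eq]
    rw [h]
    obtain ⟨p, k⟩ := p
    fin_cases k <;> simp [encQ]
  have hB₀ (p : Idx m n) : a / 2 * encQ ((2 * r) • toQuad a B₀ +
      (2 : QuadExt a) • toQuad a B₁) (p, 1) = enc B₀ p := by
    rw [hP1]
    field_simp
  have hB₁ (p : Idx m n) : 1 / 2 * encQ ((2 * r) • toQuad a B₀ +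
      (2 : QuadExt a) • toQuad a B₁) (p, 0) = enc B₁ p := by
    rw [hP0]
    field_simp
  have hA₀ (p : Idx m n) : sign F side * a * encQ (toQuad a A₁ +
      (algebraMap F (QuadExt a) (sign F side) * r) • toQuad a A₀) (p, 1) = enc A₀ p := by
    rw [hR1]
    cases side <;> simp [sign] <;> field_simp
  apply pairDec_eq_some
  rw [decodeNonsquare, Prog.eval_block, Prog.eval_call hD1, Prog.eval_block, Prog.eval_call hC1,
    Prog.eval_block, Prog.eval_block, Prog.eval_ret]
  · congr 1
    funext k
    rcases k with k | k
    · refine (eval_codeword hA₀ hR0 hB₀ hB₁ _ k).trans ?_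
      rw [hX]; rfl
    · refine (congrArg (enc (X + E) k - ·)
        (eval_codeword hA₀ hR0 hB₀ hB₁ _ k)).trans ?_
      rw [← hX]
      simp [enc]
  · funext k
    rcases k with k | k
    · refine (eval_partialFoldQ (eval_removeB (fun k => by rw [← hX]; rfl) hB₀ hB₁) _ _).trans ?_
      rw [← hr]
      rfl
    · refine (congrArg (· - _) (eval_foldQ ha (fun k => rfl) _)).trans ?_
      rw [← hr]
      exact hE k
  · funext k
    rw [hr]
    exact eval_foldQ ha (fun k => rfl) _

end Correct

/-! ### Probability of success -/

section Success

variable {F : Type u} [Field F] [Fintype F] [DecidableEq F] {m n t : ℕ}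

omit [DecidableEq F] in
theorem two_ne_zero_of_odd_card (h : Odd (Fintype.card F)) : (2 : F) ≠ 0 :=
  Ring.two_ne_zero fun h2 => by
    have := FiniteField.even_card_of_char_two h2
    rw [Nat.odd_iff.1 h] at this
    exact one_ne_zero this

-- The rank condition `hW` is all that is needed of `E`: it gives `W` rank exactly `t`, as the
-- erasure decoder demands, and the inclusion of row or column spaces.
omit [Fintype F] in
theorem decodeSquare_succeeds (h2 : (2 : F) ≠ 0) {s : F} (hs : s ≠ 0) (side : Side)
    {C D : Submodule F (Matrix (Fin m) (Fin n) F)}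
    {decC : Prog F (Idx m n ⊕ Idx m n) (Idx m n)} {decD : Prog F (Idx m n) (Idx m n)}
    (hC : CorrectsErasures side C t (erasureDec decC)) (hD : CorrectsErrors D t (errorDec decD))
    {X E : BlockMat m n F} (hX : X ∈ plotkin (s * s) C D) (hE : E.rank = t)
    (hW : ∀ r : F, r * r = s * s → (foldMat r⁻¹ E).rank = t) :
    pairDec (decodeSquare side s decD decC) (X + E) = some (X, E) := by
  obtain ⟨A₀, hA₀, A₁, hA₁, B₀, hB₀, B₁, hB₁, hX⟩ := hX
  refine pairDec_decodeSquare h2 hs side hX (fun r hr => ?_) (fun r hr => ?_)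
  · have hr0 : r ≠ 0 := by rintro rfl; simp [hs] at hr
    rw [foldMat_add, hX, foldMat_codeword (by rw [← hr]; field_simp)]
    exact hD _ (D.add_mem (D.smul_mem _ hB₀) (D.smul_mem _ hB₁)) _
      ((rank_foldMat_le _ _).trans hE.le)
  · have hr0 : r ≠ 0 := by rintro rfl; simp [hs] at hr
    have h : partMat r⁻¹ (Matrix.fromBlocks A₀ ((s * s) • A₁) A₁ A₀) side =
        A₁ + (sign F side * r⁻¹) • A₀ := by
      ext i j
      cases side
      · simp [partMat_row_apply, sign]; ring
      · simp [partMat_col_apply, sign]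
    rw [partMat_add, h]
    exact hC _ (C.add_mem hA₁ (C.smul_mem _ hA₀)) _ _ (hW r hr)
      (spaceLE_partMat_foldMat side _ E ((hW r hr).trans hE.symm))

omit [Fintype F] [DecidableEq F] in
theorem toQuad_mem_extendScalars {a : F} {C : Submodule F (Matrix (Fin m) (Fin n) F)}
    {M : Matrix (Fin m) (Fin n) F} (hM : M ∈ C) : toQuad a M ∈ extendScalars a C :=
  Submodule.subset_span ⟨M, hM, rfl⟩

theorem decodeNonsquare_succeeds (h2 : (2 : F) ≠ 0) {a : F} (ha : ¬ IsSquare a) (side : Side)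
    {C D : Submodule F (Matrix (Fin m) (Fin n) F)}
    {decC : Prog F (QIdx m n ⊕ QIdx m n) (QIdx m n)} {decD : Prog F (QIdx m n) (QIdx m n)}
    (hC : CorrectsErasures side (extendScalars a C) t (erasureDecQ decC))
    (hD : CorrectsErrors (extendScalars a D) t (errorDecQ decD))
    {X E : BlockMat m n F} (hX : X ∈ plotkin a C D) (hE : E.rank = t)
    (hW : (foldMat (⟨0, a⁻¹⟩ : QuadExt a) (toQuad a E)).rank = t) :
    pairDec (decodeNonsquare side a decD decC) (X + E) = some (X, E) := by
  have ha0 : a ≠ 0 := by rintro rfl; exact ha ⟨0, by simp⟩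
  obtain ⟨A₀, hA₀, A₁, hA₁, B₀, hB₀, B₁, hB₁, hX⟩ := hX
  refine pairDec_decodeNonsquare h2 ha0 side rfl hX ?_ ?_
  · rw [toQuad_add, foldMat_add, toQuad_codeword hX, foldMat_codeword]
    · refine hD _ (Submodule.add_mem _ (Submodule.smul_mem _ _ (toQuad_mem_extendScalars hB₀))
        (Submodule.smul_mem _ _ (toQuad_mem_extendScalars hB₁))) _ ?_
      refine (rank_foldMat_le _ _).trans ?_
      rw [rank_toQuad ha, hE]
    · ext <;> simp [ha0, QuadraticAlgebra.re_one, QuadraticAlgebra.im_one,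
        QuadraticAlgebra.algebraMap_eq]
  · have h : partMat (⟨0, a⁻¹⟩ : QuadExt a)
        (toQuad a (Matrix.fromBlocks A₀ (a • A₁) A₁ A₀)) side =
        toQuad a A₁ + (algebraMap F (QuadExt a) (sign F side) * ⟨0, a⁻¹⟩) • toQuad a A₀ := by
      ext i j <;> cases side <;>
      simp [partMat_row_apply, partMat_col_apply, sign, toQuad_apply]
    rw [toQuad_add, partMat_add, h]
    have := quadExt_fact ha
    refine hC _ (Submodule.add_mem _ (toQuad_mem_extendScalars hA₁)
      (Submodule.smul_mem _ _ (toQuad_mem_extendScalars hA₀))) _ _ hW ?_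
    refine spaceLE_partMat_foldMat side _ _ ?_
    rw [rank_toQuad ha, hE]
    exact hW

/-- If an algorithm succeeds on all rank `t` errors outside of a small set, then its probability
of success is high. -/
theorem one_sub_le_successProb (hm : t ≤ m) (hn : t ≤ n)
    (p : Prog F (BIdx m n) (BIdx m n ⊕ BIdx m n)) (X : BlockMat m n F)
    (B : Finset (BlockMat m n F)) (ε : ℝ)
    (hB : (B.card : ℝ) ≤ ε * (rankSet F (Fin m ⊕ Fin m) (Fin n ⊕ Fin n) t).card)
    (h : ∀ E : BlockMat m n F, E.rank = t → E ∉ B → pairDec p (X + E) = some (X, E)) :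
    1 - ε ≤ successProb p t X := by
  classical
  set S := rankSet F (Fin m ⊕ Fin m) (Fin n ⊕ Fin n) t with hS
  -- Without a matrix of rank `t` the probability would be `0 / 0 = 0`.
  have hSpos : 0 < S.card := by
    obtain ⟨E, hE⟩ := exists_rank_eq (L := F) (ι := Fin m ⊕ Fin m) (κ := Fin n ⊕ Fin n) (t := t)
      (by simp; omega) (by simp; omega)
    exact Finset.card_pos.2 ⟨E, mem_rankSet.2 hE⟩
  have hSset : {E : BlockMat m n F | E.rank = t} = (S : Set (BlockMat m n F)) := by
    ext E; simp [hS]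
  have hden : {E : BlockMat m n F | E.rank = t}.ncard = S.card := by
    rw [hSset, Set.ncard_coe_finset]
  have hnum : S.card ≤ B.card +
      {E : BlockMat m n F | E.rank = t ∧ pairDec p (X + E) = some (X, E)}.ncard := by
    rw [← Set.ncard_coe_finset, ← Set.ncard_coe_finset]
    refine (Set.ncard_le_ncard ?_ (Set.toFinite _)).trans (Set.ncard_union_le _ _)
    intro E hE
    have hE : E.rank = t := mem_rankSet.1 hE
    by_cases hEB : E ∈ B
    · exact Or.inl hEB
    · exact Or.inr ⟨hE, h E hE hEB⟩
  have hSpos' : (0 : ℝ) < S.card := by exact_mod_cast hSpos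
  rw [successProb, hden, le_div_iff₀ hSpos']
  have hnum' : (S.card : ℝ) ≤ B.card +
      {E : BlockMat m n F | E.rank = t ∧ pairDec p (X + E) = some (X, E)}.ncard := by
    exact_mod_cast hnum
  linarith

omit [DecidableEq F] in
theorem card_rankSet_transpose {ι κ : Type*} [Fintype ι] [Fintype κ] :
    (rankSet F κ ι t).card = (rankSet F ι κ t).card := by
  refine Finset.card_bij (fun E _ => E.transpose) (fun E hE => ?_)
    (fun E _ E' _ h => Matrix.transpose_injective h)
    (fun E hE => ⟨E.transpose, ?_, Matrix.transpose_transpose E⟩)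
  · simpa [Matrix.rank_transpose] using hE
  · simpa [Matrix.rank_transpose] using hE

-- Weakening `m` to `l` allows `l = min m n` to be used for column and row spaces alike.
omit [DecidableEq F] in
theorem card_badSet_le_zpow {κ : Type*} [Fintype κ] {l : ℕ} (hl : 0 < l) (hlm : l ≤ m) (c : F) :
    ((badSet m t κ c).card : ℝ) ≤ 2 * (Fintype.card F : ℝ) ^ ((t : ℤ) - l - 1) *
      (rankSet F (Fin m ⊕ Fin m) κ t).card := by
  have h : ((Fintype.card F * Fintype.card F ^ m * (badSet m t κ c).card : ℕ) : ℝ) ≤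
      (2 * (rankSet F (Fin m ⊕ Fin m) κ t).card * Fintype.card F ^ t : ℕ) :=
    Nat.cast_le.2 (card_badSet_le (hl.trans_le hlm) c)
  push_cast at h
  have hq : (1 : ℝ) < Fintype.card F := by exact_mod_cast Fintype.one_lt_card
  have hq0 : (0 : ℝ) < Fintype.card F := by linarith
  have hlm' : (Fintype.card F : ℝ) ^ l ≤ (Fintype.card F : ℝ) ^ m := pow_le_pow_right₀ hq.le hlm
  rw [zpow_sub₀ hq0.ne', zpow_sub₀ hq0.ne', zpow_natCast, zpow_natCast, zpow_one]
  have hpos : (0 : ℝ) < Fintype.card F * (Fintype.card F : ℝ) ^ l := by positivity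
  refine le_of_mul_le_mul_left ?_ hpos
  calc _ ≤ (Fintype.card F : ℝ) * (Fintype.card F : ℝ) ^ m * ((badSet m t κ c).card : ℝ) := by
        gcongr
    _ ≤ _ := h
    _ = _ := by field_simp

omit [DecidableEq F] in
theorem card_badSetQ_le_zpow {κ : Type*} [Fintype κ] {l : ℕ} (hl : 0 < l) (hlm : l ≤ m) {α β : F}
    (hαβ : ¬ IsSquare (α * β)) :
    ((badSetQ m t κ α β).card : ℝ) ≤ 4 * (Fintype.card F : ℝ) ^ (2 * (t : ℤ) - 2 * l - 2) *
      (rankSet F (Fin m ⊕ Fin m) κ t).card := by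
  have h : ((Fintype.card F ^ 2 * Fintype.card F ^ (2 * m) * (badSetQ m t κ α β).card : ℕ) : ℝ) ≤
      (4 * (rankSet F (Fin m ⊕ Fin m) κ t).card * Fintype.card F ^ (2 * t) : ℕ) :=
    Nat.cast_le.2 (card_badSetQ_le (hl.trans_le hlm) hαβ)
  push_cast at h
  have hq : (1 : ℝ) < Fintype.card F := by exact_mod_cast Fintype.one_lt_card
  have hq0 : (0 : ℝ) < Fintype.card F := by linarith
  have hlm' : (Fintype.card F : ℝ) ^ (2 * l) ≤ (Fintype.card F : ℝ) ^ (2 * m) :=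
    pow_le_pow_right₀ hq.le (by omega)
  have hexp : (Fintype.card F : ℝ) ^ (2 * (t : ℤ) - 2 * l - 2) =
      (Fintype.card F : ℝ) ^ (2 * t) / (Fintype.card F : ℝ) ^ (2 * l) /
        (Fintype.card F : ℝ) ^ 2 := by
    rw [zpow_sub₀ hq0.ne', zpow_sub₀ hq0.ne']
    norm_cast
  rw [hexp]
  have hpos : (0 : ℝ) < (Fintype.card F : ℝ) ^ 2 * (Fintype.card F : ℝ) ^ (2 * l) := by positivity
  refine le_of_mul_le_mul_left ?_ hpos
  calc _ ≤ (Fintype.card F : ℝ) ^ 2 * (Fintype.card F : ℝ) ^ (2 * m) *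
        ((badSetQ m t κ α β).card : ℝ) := by
        gcongr
    _ ≤ _ := h
    _ = _ := by field_simp

theorem decodeSquare_successProb (h2 : (2 : F) ≠ 0) (ht : 0 < t) (hmn : 2 * t ≤ min m n) {s : F}
    (hs : s ≠ 0) (side : Side) {C D : Submodule F (Matrix (Fin m) (Fin n) F)}
    {decC : Prog F (Idx m n ⊕ Idx m n) (Idx m n)} {decD : Prog F (Idx m n) (Idx m n)}
    (hC : CorrectsErasures side C t (erasureDec decC)) (hD : CorrectsErrors D t (errorDec decD))
    {X : BlockMat m n F} (hX : X ∈ plotkin (s * s) C D) :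
    1 - 8 * (Fintype.card F : ℝ) ^ ((t : ℤ) - (min m n : ℕ) - 1) ≤
      successProb (decodeSquare side s decD decC) t X := by
  have hl : 0 < min m n := by omega
  let Bc (r : F) := badSet m t (Fin n ⊕ Fin n) (-r⁻¹)
  -- Row spaces of `E` are column spaces of its transpose. Four bad sets, each of proportion at most
  -- `2 q^(t - min m n - 1)`, give the constant `8`.
  let Br (r : F) := (badSet n t (Fin m ⊕ Fin m) r⁻¹⁻¹).image Matrix.transpose
  have hBc (r : F) := card_badSet_le_zpow (t := t) (κ := Fin n ⊕ Fin n) hl (min_le_left m n) (-r⁻¹)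
  have hBr (r : F) := card_badSet_le_zpow (t := t) (κ := Fin m ⊕ Fin m) hl (min_le_right m n) r⁻¹⁻¹
  simp_rw [card_rankSet_transpose (ι := Fin m ⊕ Fin m)] at hBr
  refine one_sub_le_successProb (by omega) (by omega) _ X
    ((Bc s ∪ Br s) ∪ (Bc (-s) ∪ Br (-s))) _ ?_ (fun E hE hEB => ?_)
  · have hcard : (((Bc s ∪ Br s) ∪ (Bc (-s) ∪ Br (-s))).card : ℝ) ≤
        ((Bc s).card + (badSet n t (Fin m ⊕ Fin m) s⁻¹⁻¹).card) +
        ((Bc (-s)).card + (badSet n t (Fin m ⊕ Fin m) (-s)⁻¹⁻¹).card) := by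
      norm_cast
      refine (Finset.card_union_le _ _).trans (add_le_add ?_ ?_) <;>
      exact (Finset.card_union_le _ _).trans (add_le_add le_rfl Finset.card_image_le)
    linarith [hBc s, hBc (-s), hBr s, hBr (-s)]
  · refine decodeSquare_succeeds h2 hs side hC hD hX hE fun r hr => ?_
    have hr0 : r ≠ 0 := by rintro rfl; simp [hs] at hr
    simp only [Finset.mem_union, not_or] at hEB
    have hEr : E ∉ Bc r ∧ E ∉ Br r := by
      rcases mul_self_eq_mul_self_iff.1 hr with rfl | rfl
      · exact hEB.1
      · exact hEB.2
    exact rank_foldMat_eq_of_notMem_badSet (inv_ne_zero hr0) hE hEr.1 fun h =>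
      hEr.2 (Finset.mem_image.2 ⟨_, h, Matrix.transpose_transpose E⟩)

theorem decodeNonsquare_successProb (h2 : (2 : F) ≠ 0) (ht : 0 < t) (hmn : 2 * t ≤ min m n)
    {a : F} (ha : ¬ IsSquare a) (side : Side) {C D : Submodule F (Matrix (Fin m) (Fin n) F)}
    {decC : Prog F (QIdx m n ⊕ QIdx m n) (QIdx m n)} {decD : Prog F (QIdx m n) (QIdx m n)}
    (hC : CorrectsErasures side (extendScalars a C) t (erasureDecQ decC))
    (hD : CorrectsErrors (extendScalars a D) t (errorDecQ decD))
    {X : BlockMat m n F} (hX : X ∈ plotkin a C D) :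
    1 - 8 * (Fintype.card F : ℝ) ^ (2 * (t : ℤ) - 2 * (min m n : ℕ) - 2) ≤
      successProb (decodeNonsquare side a decD decC) t X := by
  have hl : 0 < min m n := by omega
  have hinv : ¬ IsSquare a⁻¹ := by rwa [isSquare_inv]
  -- For columns and rows alike `α β = a⁻¹`, a nonsquare. Two bad sets with constant `4` give `8`.
  have hBc := card_badSetQ_le_zpow (t := t) (κ := Fin n ⊕ Fin n) (α := -1) (β := -a⁻¹) hl
    (min_le_left m n) (by simpa using hinv)
  have hBr := card_badSetQ_le_zpow (t := t) (κ := Fin m ⊕ Fin m) (α := a⁻¹) (β := 1) hl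
    (min_le_right m n) (by simpa using hinv)
  rw [card_rankSet_transpose (ι := Fin m ⊕ Fin m)] at hBr
  refine one_sub_le_successProb (by omega) (by omega) _ X
    (badSetQ m t (Fin n ⊕ Fin n) (-1) (-a⁻¹) ∪
      (badSetQ n t (Fin m ⊕ Fin m) a⁻¹ 1).image Matrix.transpose) _ ?_ (fun E hE hEB => ?_)
  · have hcard : ((badSetQ m t (Fin n ⊕ Fin n) (-1) (-a⁻¹) ∪
        (badSetQ n t (Fin m ⊕ Fin m) a⁻¹ 1).image Matrix.transpose).card : ℝ) ≤
        (badSetQ m t (Fin n ⊕ Fin n) (-1) (-a⁻¹)).card +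
          (badSetQ n t (Fin m ⊕ Fin m) a⁻¹ 1).card := by
      norm_cast
      exact (Finset.card_union_le _ _).trans (add_le_add le_rfl Finset.card_image_le)
    linarith
  · simp only [Finset.mem_union, not_or] at hEB
    refine decodeNonsquare_succeeds h2 ha side hC hD hX hE ?_
    exact rank_foldMat_toQuad_eq_of_notMem_badSetQ ha hE hEB.1 fun h =>
      hEB.2 (Finset.mem_image.2 ⟨_, h, Matrix.transpose_transpose E⟩)

end Success

end RankPlotkin

/-! ### The main theorem -/

theorem mainTheorem6 :
    ∃ K : ℕ, ∀ (F : Type u) [Field F] [Fintype F] [DecidableEq F], Odd (Fintype.card F) →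
      ∀ (m n t : ℕ), 0 < t → 2 * t ≤ min m n →
      ∀ (side : Side) (C D : Submodule F (Matrix (Fin m) (Fin n) F)) (a : F), a ≠ 0 →
        -- `a` is a square in `F`, and `s` is the chosen square root
        (∀ s : F, s * s = a →
          ∀ (decC : Prog F (Idx m n ⊕ Idx m n) (Idx m n)) (decD : Prog F (Idx m n) (Idx m n))
            (c d : ℕ),
            CorrectsErasures side C t (erasureDec decC) → decC.CostAtMost c →
            CorrectsErrors D t (errorDec decD) → decD.CostAtMost d →
            (∀ X ∈ plotkin a C D,
              1 - (K : ℝ) * (Fintype.card F : ℝ) ^ ((t : ℤ) - (min m n : ℕ) - 1) ≤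
                successProb (decodeSquare side s decD decC) t X) ∧
            (decodeSquare side s decD decC).CostAtMost (K * (m * n) + 2 * (c + d))) ∧
        -- `a` is not a square in `F`
        (¬ IsSquare a →
          ∀ (decC : Prog F (QIdx m n ⊕ QIdx m n) (QIdx m n)) (decD : Prog F (QIdx m n) (QIdx m n))
            (c d : ℕ),
            CorrectsErasures side (extendScalars a C) t (erasureDecQ decC) → decC.CostAtMost c →
            CorrectsErrors (extendScalars a D) t (errorDecQ decD) → decD.CostAtMost d →
            (∀ X ∈ plotkin a C D,
              1 - (K : ℝ) * (Fintype.card F : ℝ) ^ (2 * (t : ℤ) - 2 * (min m n : ℕ) - 2) ≤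
                successProb (decodeNonsquare side a decD decC) t X) ∧
            (decodeNonsquare side a decD decC).CostAtMost (K * (m * n) + (c + d))) := by
  -- One constant serves both purposes: `8` would do for the probabilities, and `64` bounds the
  -- operation counts.
  refine ⟨64, fun F _ _ _ hodd m n t ht hmn side C D a ha => ⟨?_, ?_⟩⟩
  · rintro s rfl decC decD c d hC hc hD hd
    refine ⟨fun X hX => le_trans ?_ (decodeSquare_successProb (two_ne_zero_of_odd_card hodd) ht hmn
      (left_ne_zero_of_mul ha) side hC hD hX), decodeSquare_costAtMost side s hc hd⟩
    gcongr
    norm_num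
  · intro hns decC decD c d hC hc hD hd
    refine ⟨fun X hX => le_trans ?_ (decodeNonsquare_successProb (two_ne_zero_of_odd_card hodd) ht
      hmn hns side hC hD hX), decodeNonsquare_costAtMost side a hc hd⟩
    gcongr
    norm_num
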